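/- Let $G$ be a finite directed graph with vertices $v_i$, $i\in V$, and edges $e_j$, $j\in E$ (loops and parallel edges allowed). Put $\phi^-_{ij}=1$ if $e_j$ leaves $v_i$ and $\phi^-_{ij}=0$ otherwise, $\phi^+_{ij}=1$ if $e_j$ enters $v_i$ and $\phi^+_{ij}=0$ otherwise. Let $\omega_{ij}:\mathbb R\to[0,\infty)$ ($i\in V$, $j\in E$) be weights with $\omega_{ij}\equiv 0$ whenever $\phi^-_{ij}=0$, and $\sum_{j}\omega_{ij}(t)=1$ for all $i\in V$ and $t\ge 0$. Let $\mathbb B_w(t)=(\Phi_w^-(t))^T\Phi^+$, where $\Phi^+=(\phi^+_{ij})$ and $\Phi_w^-(t)$ has the entry $\omega_{ij}(t)$ if $e_j$ leaves $v_i$ and $0$ otherwise. Let $X=L^1([0,1],\mathbb C^{E})$. The non-autonomous network flow problem $(nF)$, i.e. $\partial_t u_j=\partial_x u_j$ on $(0,1)$, $t\ge s$, with $u(\cdot,s)=f_s$ and $\phi^-_{ij}u_j(1,t)=\omega_{ij}(t)\sum_k\phi^+_{ik}u_k(0,t)$, is understood as the Cauchy problem $\dot u(t)=A(t)u(t)$,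 $t\ge s$, $u(s)=f_s\in X$, where $A(t)f=f'$ and $$D(A(t))=\Big\{f\in W^{1,1}([0,1],\mathbb C^{E}) : \phi^-_{ij}f_j(1)=\omega_{ij}(t)\sum_k\phi^+_{ik}f_k(0)\ \text{ for all } i,j\Big\}=\big\{f\in W^{1,1}([0,1],\mathbb C^{E}) : f(1)=\mathbb B_w(t)f(0)\big\}.$$ A classical solution (starting at time $s\in\mathbb R$) is a function $u\in C^1([s,\infty),X)$ with $u(t)\in D(A(t))$ and $\dot u(t)=A(t)u(t)$ for all $t\ge s$. An evolution family is a family of bounded operators $(U(t,s))_{t\ge s}$ on $X$ with $U(s,s)=I$, $U(t,s)=U(t,r)U(r,s)$ for $t\ge r\ge s$, and $(t,s)\mapsto U(t,s)f$ continuous on $\{t\ge s\}$ for every $f\in X$. The problem is well-posed if there is exactly one evolution family such that for every $s\in\mathbb R$ the regularity subspace $Y_s=\{f\in X : t\mapsto U(t,s)f \text{ is a classical solution on } [s,\infty)\}$ is dense in $X$. Suppose that all the functions $\omega_{ij}$ are absolutely continuous on every compact interval. Then $(nF)$ is well-posed. If in addition $\mathbb B_w(t+1)=\mathbb B_w(t)$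 for all $t\in\mathbb R$, then the evolution family is given, for all $t\ge s$, all $f\in X$ and almost every $x\in[0,1]$, by $$(U(t,s)f)(x)=\mathbb B_w(t+x)^k f(x+t-s-k),\qquad k\in\mathbb N_0,\ k\le x+t-s<k+1,$$ and classical solutions are unique: every classical solution $u$ starting at time $s$ with $u(s)=f_s$ satisfies $u(t)=U(t,s)f_s$ for all $t\ge s$. -/

import Mathlib

open MeasureTheory Set Matrix

/-- A finite directed graph with vertex set `V` and edge set `E`: the edge `j` runs from the
vertex `tail j` to the vertex `head j`. Loops and parallel edges are allowed. -/
structure FlowNetwork (V E : Type*) where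
  tail : E → V
  head : E → V

namespace FlowNetwork

variable {V E : Type*} [Fintype V] [DecidableEq V] [Fintype E]

/-- The outgoing incidence matrix: the entry at `(i, j)` is `1` if the edge `j` leaves the
vertex `i`, and `0` otherwise. -/
def outInc (G : FlowNetwork V E) : Matrix V E ℝ :=
  Matrix.of fun i j => if G.tail j = i then 1 else 0

/-- The incoming incidence matrix: the entry at `(i, j)` is `1` if the edge `j` enters the
vertex `i`, and `0` otherwise. -/
def inInc (G : FlowNetwork V E) : Matrix V E ℝ :=
  Matrix.of fun i j => if G.head j = i then 1 else 0

/-- The weighted outgoing incidence matrix at time `t`. -/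
def weightedOutInc (G : FlowNetwork V E) (ω : V → E → ℝ → ℝ) (t : ℝ) : Matrix V E ℝ :=
  Matrix.of fun i j => if G.tail j = i then ω i j t else 0

/-- The weighted adjacency matrix of the line graph at time `t`. -/
def Bw (G : FlowNetwork V E) (ω : V → E → ℝ → ℝ) (t : ℝ) : Matrix E E ℝ :=
  (G.weightedOutInc ω t)ᵀ * G.inInc

end FlowNetwork

/-- The state space `L¹([0,1], ℂ^E)`. (All norms on `ℂ^E` are equivalent and give the same
space with the same topology.) -/
abbrev FlowSpace (E : Type*) [Fintype E] : Type _ :=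
  Lp (E → ℂ) 1 (volume.restrict (Icc (0 : ℝ) 1))

section AbstractCauchy

variable {E : Type*} [Fintype E]

/-- `g` is the weak derivative of `f` on `(0,1)`. As `f` and `g` are both integrable, this says
in particular that `f` belongs to the Sobolev space `W^{1,1}([0,1], ℂ^E)`, with `f' = g`. -/
def IsWeakDeriv (f g : FlowSpace E) : Prop :=
  ∀ φ : ℝ → ℝ, ContDiff ℝ ((⊤ : ℕ∞) : WithTop ℕ∞) φ → HasCompactSupport φ → tsupport φ ⊆ Ioo 0 1 →
    ∫ x in Icc (0 : ℝ) 1, deriv φ x • f x = - ∫ x in Icc (0 : ℝ) 1, φ x • g x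

/-- The boundary values `f(0)` and `f(1)`, taken along the continuous representative of `f`,
are `a` and `b`. -/
def HasTraces (f : FlowSpace E) (a b : E → ℂ) : Prop :=
  ∃ F : ℝ → E → ℂ, ContinuousOn F (Icc 0 1) ∧
    (∀ᵐ x ∂(volume.restrict (Icc (0 : ℝ) 1)), f x = F x) ∧ F 0 = a ∧ F 1 = b

/-- The graph of the first derivative on `L¹([0,1], ℂ^E)` under the boundary condition `bc`
between `f(0)` and `f(1)`: the domain is the set of all `f` in `W^{1,1}` with
`bc f(0) f(1)`, and `f` is sent to `g = f'`. -/
def BoundaryDerivOp (bc : (E → ℂ) → (E → ℂ) → Prop) (f g : FlowSpace E) : Prop :=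
  IsWeakDeriv f g ∧ ∃ a b : E → ℂ, HasTraces f a b ∧ bc a b

/-- `u` is a classical solution of `u'(t) = A(t) u(t)`, `t ≥ s`. The operators `A(t)` are given
by their graphs: `A t f g` means that `f` is in the domain of `A(t)` and `A(t) f = g`. -/
def IsClassicalSolution (A : ℝ → FlowSpace E → FlowSpace E → Prop) (s : ℝ)
    (u : ℝ → FlowSpace E) : Prop :=
  ContDiffOn ℝ 1 u (Ici s) ∧ ∀ t ∈ Ici s, A t (u t) (derivWithin u (Ici s) t)

/-- A strongly continuous evolution family of bounded operators `U(t,s)`, `t ≥ s`. Only the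
values `U t s` with `s ≤ t` carry meaning. -/
structure IsEvolutionFamily (U : ℝ → ℝ → FlowSpace E →L[ℂ] FlowSpace E) : Prop where
  refl : ∀ s, U s s = ContinuousLinearMap.id ℂ (FlowSpace E)
  comp : ∀ t r s, s ≤ r → r ≤ t → U t s = (U t r).comp (U r s)
  cont : ∀ f, ContinuousOn (fun p : ℝ × ℝ => U p.1 p.2 f) {p | p.2 ≤ p.1}

/-- The regularity subspace at time `s`: all `f` for which `t ↦ U(t,s) f` is a classical
solution on `[s,∞)`. -/
def regularitySpace (A : ℝ → FlowSpace E → FlowSpace E → Prop)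
    (U : ℝ → ℝ → FlowSpace E →L[ℂ] FlowSpace E) (s : ℝ) : Set (FlowSpace E) :=
  {f | IsClassicalSolution A s (fun t => U t s f)}

/-- `U` is an evolution family whose regularity subspaces are all dense. -/
def SolvesCauchy (A : ℝ → FlowSpace E → FlowSpace E → Prop)
    (U : ℝ → ℝ → FlowSpace E →L[ℂ] FlowSpace E) : Prop :=
  IsEvolutionFamily U ∧ ∀ s, Dense (regularitySpace A U s)

/-- Well-posedness: there is exactly one evolution family (on `t ≥ s`) with dense regularity
subspaces. -/
def IsWellPosed (A : ℝ → FlowSpace E → FlowSpace E → Prop) : Prop :=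
  ∃ U, SolvesCauchy A U ∧ ∀ W, SolvesCauchy A W → ∀ s t, s ≤ t → W t s = U t s

end AbstractCauchy

namespace FlowNetwork

variable {V E : Type*} [Fintype V] [DecidableEq V] [Fintype E]

/-- The boundary condition of the network flow at time `t`, for the values `a = u(0,t)` and
`b = u(1,t)`: at every vertex the incoming material is distributed to the outgoing edges
according to the weights. -/
def BoundaryCondition (G : FlowNetwork V E) (ω : V → E → ℝ → ℝ) (t : ℝ) (a b : E → ℂ) : Prop :=
  ∀ i j, (G.outInc i j : ℂ) * b j = (ω i j t : ℂ) * ∑ k, (G.inInc i k : ℂ) * a k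

/-- The (graphs of the) operators of the non-autonomous network flow problem. -/
def flowOp (G : FlowNetwork V E) (ω : V → E → ℝ → ℝ) (t : ℝ) :
    FlowSpace E → FlowSpace E → Prop :=
  BoundaryDerivOp (G.BoundaryCondition ω t)

/-- The boundary condition says `u(1,t) = Bw(t) u(0,t)`. -/
theorem boundaryCondition_iff (G : FlowNetwork V E) (ω : V → E → ℝ → ℝ)
    (hoff : ∀ i j, G.outInc i j = 0 → ∀ t, ω i j t = 0) (t : ℝ) (a b : E → ℂ) :
    G.BoundaryCondition ω t a b ↔ b = (G.Bw ω t).map Complex.ofReal *ᵥ a := by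
  have key : ∀ j, ((G.Bw ω t).map Complex.ofReal *ᵥ a) j =
      (ω (G.tail j) j t : ℂ) * ∑ k, (G.inInc (G.tail j) k : ℂ) * a k := by
    intro j
    simp [Bw, Matrix.mulVec, dotProduct, Matrix.mul_apply, weightedOutInc, Finset.mul_sum,
      mul_assoc]
  constructor
  · intro h
    funext j
    rw [key, ← h (G.tail j) j]
    simp [outInc]
  · rintro rfl i j
    rw [key]
    by_cases hij : G.tail j = i
    · subst hij; simp [outInc]
    · have h0 : G.outInc i j = 0 := by simp [outInc, hij]
      simp [h0, hoff i j h0 t]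

end FlowNetwork

/-!
The flow is solved along its characteristics. A solution of `u_t = u_x` depends on `t + x` only, so
`u(x,t) = g(t + x)` for a function `g` on `[s, ∞)`, and the boundary condition
`u(1,t) = B(t) u(0,t)` turns into the recursion `g(τ + 1) = B(τ) g(τ)`. The initial value prescribes
`g` on `[s, s + 1]`, and the recursion determines the rest:
`g(τ) = B(τ - 1) ⋯ B(τ - k) g(τ - k)`. This product is `B(τ)^k` when `B` has period `1`.

*Existence.* `flowEvolution` writes this formula as a locally finite sum over the number `k` of
passages through the vertices. Each summand is a truncated translation of the initial value,
followed by multiplication with a continuous matrix function, hence strongly continuous in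
`(t, s)`. The evolution law holds as both of its sides continue the same `g`
(`flowEvolution_ae_of_recursion`).
If the initial value is a test function on `(0,1)`, then `g` is locally absolutely continuous,
because the weights are; thus `t ↦ g(t + ·)` is continuously differentiable into `L¹`
(`hasDerivAt_window`) and a classical solution. Test functions are dense in `L¹`.

*Uniqueness.* For a classical solution `u`, the weak derivative is integrated by the
du Bois-Reymond lemma, and `∫₀^{c-r} u(r)` is differentiated in `r`. The motion of the endpoint and
the evolution of `u` cancel up to the outflow `-u(0,r)`, so `∫₀ˣ u(t)` equals the integral of the
trace `g(τ) = u(0,τ)` over `[t, t + x]`, that is, `u(t) = g(t + ·)`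
(`exists_recursion_of_isClassicalSolution`). Hence `u` is given by `flowEvolution`. An evolution
family with dense regularity subspaces then agrees with `flowEvolution` on dense sets, so everywhere.
-/

namespace NetworkFlow

open Filter Topology

/-! ### Locally absolutely continuous functions -/

section LocPrim

variable {F : Type*} [NormedAddCommGroup F]

theorem intervalIntegrable_of_locallyIntegrable {f : ℝ → F}
    (hf : LocallyIntegrable f volume) (a b : ℝ) : IntervalIntegrable f volume a b :=
  intervalIntegrable_iff.mpr <|
    (hf.integrableOn_isCompact isCompact_uIcc).mono_set uIoc_subset_uIcc

theorem locallyIntegrable_of_intervalIntegrable {f : ℝ → F}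
    (hf : ∀ a b, IntervalIntegrable f volume a b) : LocallyIntegrable f volume := by
  intro x
  refine ⟨Ioo (x - 1) (x + 1), Ioo_mem_nhds (by linarith) (by linarith), ?_⟩
  exact ((intervalIntegrable_iff_integrableOn_Ioc_of_le (by linarith)).1
    (hf (x - 1) (x + 1))).mono_set Ioo_subset_Ioc_self

variable [NormedSpace ℝ F]

/-- `w` is a locally absolutely continuous function on `ℝ` with density `w'`: a primitive of the
locally integrable function `w'`. -/
structure IsPrimitive (w w' : ℝ → F) : Prop where
  locallyIntegrable : LocallyIntegrable w' volume
  sub_eq : ∀ a b, w b - w a = ∫ x in a..b, w' x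

theorem absolutelyContinuousOnInterval_of_dist_le {X Y : Type*} [PseudoMetricSpace X]
    [PseudoMetricSpace Y] {f : ℝ → X} {g : ℝ → Y} {a b : ℝ}
    (hg : AbsolutelyContinuousOnInterval g a b)
    (hfg : ∀ x y, dist (f x) (f y) ≤ dist (g x) (g y)) :
    AbsolutelyContinuousOnInterval f a b :=
  squeeze_zero (fun _ => Finset.sum_nonneg fun _ _ => dist_nonneg)
    (fun _ => Finset.sum_le_sum fun _ _ => hfg _ _) hg

theorem absolutelyContinuousOnInterval_integral {f : ℝ → F}
    (hf : LocallyIntegrable f volume) (c a b : ℝ) :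
    AbsolutelyContinuousOnInterval (fun x => ∫ y in c..x, f y) a b := by
  have hi := intervalIntegrable_of_locallyIntegrable hf
  have hi' := intervalIntegrable_of_locallyIntegrable (f := fun x => ‖f x‖) fun x => (hf x).norm
  refine absolutelyContinuousOnInterval_of_dist_le (g := fun x => ∫ y in a..x, ‖f y‖)
    ((hi' a b).absolutelyContinuousOnInterval_intervalIntegral (by simp)) fun x y => ?_
  rw [dist_eq_norm, dist_eq_norm, intervalIntegral.integral_interval_sub_left (hi _ _) (hi _ _),
    intervalIntegral.integral_interval_sub_left (hi' _ _) (hi' _ _), Real.norm_eq_abs]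
  exact intervalIntegral.norm_integral_le_abs_integral_norm

namespace IsPrimitive

variable {w w' v v' : ℝ → F}

theorem absolutelyContinuousOnInterval (h : IsPrimitive w w') (a b : ℝ) :
    AbsolutelyContinuousOnInterval w a b := by
  refine absolutelyContinuousOnInterval_of_dist_le
    (absolutelyContinuousOnInterval_integral h.locallyIntegrable a a b) fun x y => ?_
  have hi := intervalIntegrable_of_locallyIntegrable h.locallyIntegrable
  rw [dist_eq_norm, dist_eq_norm, intervalIntegral.integral_interval_sub_left (hi _ _) (hi _ _),
    h.sub_eq]

theorem continuous (h : IsPrimitive w w') : Continuous w := by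
  have : w = fun x => w 0 + ∫ y in (0 : ℝ)..x, w' y := by
    funext x
    rw [← h.sub_eq]
    abel
  rw [this]
  exact continuous_const.add (intervalIntegral.continuous_primitive
    (intervalIntegrable_of_locallyIntegrable h.locallyIntegrable) 0)

theorem sum {ι : Type*} (s : Finset ι) {w w' : ι → ℝ → F} (h : ∀ i ∈ s, IsPrimitive (w i) (w' i)) :
    IsPrimitive (fun x => ∑ i ∈ s, w i x) (fun x => ∑ i ∈ s, w' i x) := by
  refine ⟨?_, fun a b => ?_⟩
  · exact locallyIntegrable_finsetSum _ fun i hi => (h i hi).locallyIntegrable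
  · rw [intervalIntegral.integral_finsetSum
      fun i hi => intervalIntegrable_of_locallyIntegrable (h i hi).locallyIntegrable a b,
      ← Finset.sum_sub_distrib]
    exact Finset.sum_congr rfl fun i hi => (h i hi).sub_eq a b

theorem comp_add_right (h : IsPrimitive w w') (c : ℝ) :
    IsPrimitive (fun x => w (x + c)) (fun x => w' (x + c)) := by
  refine ⟨locallyIntegrable_of_intervalIntegrable fun a b => ?_, fun a b => ?_⟩
  · simpa using (intervalIntegrable_of_locallyIntegrable h.locallyIntegrable
      (a + c) (b + c)).comp_add_right c
  · rw [h.sub_eq, intervalIntegral.integral_comp_add_right]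

variable [CompleteSpace F]

theorem ae_hasDerivAt (h : IsPrimitive w w') : ∀ᵐ x, HasDerivAt w (w' x) x := by
  filter_upwards [LocallyIntegrable.ae_hasDerivAt_integral h.locallyIntegrable] with x hx
  have : w = fun x => w 0 + ∫ y in (0 : ℝ)..x, w' y := by
    funext x
    rw [← h.sub_eq]
    abel
  rw [this]
  exact (hx 0).const_add _

/-- The fundamental theorem of calculus for vector-valued absolutely continuous functions that are
differentiable almost everywhere. -/
theorem of_ae_hasDerivAt (hac : ∀ a b, AbsolutelyContinuousOnInterval w a b)
    (hi : LocallyIntegrable w' volume) (hd : ∀ᵐ x, HasDerivAt w (w' x) x) :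
    IsPrimitive w w' := by
  refine ⟨hi, fun a b => ?_⟩
  have hg : ∀ᵐ x, x ∈ uIcc a b → HasDerivAt (w - fun x => ∫ y in a..x, w' y) 0 x := by
    filter_upwards [hd, LocallyIntegrable.ae_hasDerivAt_integral hi] with x hx hx' _
    simpa using hx.sub (hx' a)
  obtain ⟨C, hC⟩ := ((hac a b).sub
    (absolutelyContinuousOnInterval_integral hi a a b)).const_of_ae_hasDerivAt_zero hg
  have h1 := hC a (by simp)
  have h2 := hC b (by simp)
  simp only [Pi.sub_apply, intervalIntegral.integral_same, sub_zero] at h1 h2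
  rw [h1, ← h2]
  abel

theorem of_real {b : ℝ → ℝ} (hb : ∀ x y, AbsolutelyContinuousOnInterval b x y) :
    IsPrimitive b (deriv b) :=
  ⟨locallyIntegrable_of_intervalIntegrable fun x y => (hb x y).intervalIntegrable_deriv,
    fun x y => (hb x y).integral_deriv_eq_sub.symm⟩

theorem of_contDiff (hw : ContDiff ℝ 1 w) : IsPrimitive w (deriv w) := by
  have hc : Continuous (deriv w) := hw.continuous_deriv le_rfl
  refine ⟨hc.locallyIntegrable, fun a b => ?_⟩
  rw [intervalIntegral.integral_deriv_eq_sub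
    (fun x _ => (hw.differentiable one_ne_zero).differentiableAt) (hc.intervalIntegrable _ _)]

theorem smul {b b' : ℝ → ℝ} (hb : IsPrimitive b b') (h : IsPrimitive w w') :
    IsPrimitive (fun x => b x • w x) (fun x => b x • w' x + b' x • w x) := by
  refine of_ae_hasDerivAt (fun x y => (hb.absolutelyContinuousOnInterval x y).smul
    (h.absolutelyContinuousOnInterval x y)) ?_ ?_
  · refine locallyIntegrable_of_intervalIntegrable fun x y => ?_
    exact ((intervalIntegrable_of_locallyIntegrable h.locallyIntegrable x y).continuousOn_smul
      hb.continuous.continuousOn).add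
      ((intervalIntegrable_of_locallyIntegrable hb.locallyIntegrable x y).smul_continuousOn
      h.continuous.continuousOn)
  · filter_upwards [hb.ae_hasDerivAt, h.ae_hasDerivAt] with x h1 h2
    exact h1.smul h2

theorem clm_comp {G : Type*} [NormedAddCommGroup G] [NormedSpace ℝ G] [CompleteSpace G]
    (L : F →L[ℝ] G) (h : IsPrimitive w w') :
    IsPrimitive (fun x => L (w x)) (fun x => L (w' x)) := by
  refine ⟨fun x => (h.locallyIntegrable x).imp fun s hs => ⟨hs.1, L.integrable_comp hs.2⟩,
    fun a b => ?_⟩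
  rw [← map_sub, h.sub_eq, ContinuousLinearMap.intervalIntegral_comp_comm]
  exact intervalIntegrable_of_locallyIntegrable h.locallyIntegrable a b

end IsPrimitive

end LocPrim

/-! ### Test functions and weak derivatives -/

section TestFunctions

variable {F : Type*} [NormedAddCommGroup F] [NormedSpace ℝ F]

/-- A test function on the open interval `(0,1)`. -/
structure IsTestFunction (φ : ℝ → F) : Prop where
  contDiff : ContDiff ℝ ((⊤ : ℕ∞) : WithTop ℕ∞) φ
  hasCompactSupport : HasCompactSupport φ
  tsupport_subset : tsupport φ ⊆ Ioo 0 1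

theorem setIntegral_Icc_eq_intervalIntegral (f : ℝ → F) :
    ∫ x in Icc (0 : ℝ) 1, f x = ∫ x in (0 : ℝ)..1, f x := by
  rw [integral_Icc_eq_integral_Ioc, intervalIntegral.integral_of_le zero_le_one]

theorem setIntegral_Icc_eq_integral {f : ℝ → F} (hf : ∀ x ∉ Ioo (0 : ℝ) 1, f x = 0) :
    ∫ x in Icc (0 : ℝ) 1, f x = ∫ x, f x :=
  setIntegral_eq_integral_of_forall_compl_eq_zero fun x hx =>
    hf x fun h => hx (Ioo_subset_Icc_self h)

namespace IsTestFunction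

theorem eq_zero {φ : ℝ → F} (h : IsTestFunction φ) {x : ℝ} (hx : x ∉ Ioo (0 : ℝ) 1) : φ x = 0 :=
  image_eq_zero_of_notMem_tsupport fun h' => hx (h.tsupport_subset h')

theorem isPrimitive [CompleteSpace F] {φ : ℝ → F} (h : IsTestFunction φ) :
    IsPrimitive φ (deriv φ) :=
  .of_contDiff (h.contDiff.of_le (by exact_mod_cast le_top))

theorem continuous {φ : ℝ → F} (h : IsTestFunction φ) : Continuous φ := h.contDiff.continuous

theorem integrable {φ : ℝ → F} (h : IsTestFunction φ) : Integrable φ :=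
  h.continuous.integrable_of_hasCompactSupport h.hasCompactSupport

/-- Integration by parts against an absolutely continuous function. -/
theorem integral_deriv_smul [CompleteSpace F] {φ : ℝ → ℝ} (h : IsTestFunction φ) {w w' : ℝ → F}
    (hw : IsPrimitive w w') :
    ∫ x in Icc (0 : ℝ) 1, deriv φ x • w x = - ∫ x in Icc (0 : ℝ) 1, φ x • w' x := by
  have h0 := (h.isPrimitive.smul hw).sub_eq 0 1
  rw [h.eq_zero (by simp), h.eq_zero (by simp), intervalIntegral.integral_add] at h0
  · rw [setIntegral_Icc_eq_intervalIntegral, setIntegral_Icc_eq_intervalIntegral,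
      eq_neg_iff_add_eq_zero, add_comm, ← h0]
    simp
  · exact (intervalIntegrable_of_locallyIntegrable hw.locallyIntegrable 0 1).continuousOn_smul
      h.continuous.continuousOn
  · exact (intervalIntegrable_of_locallyIntegrable h.isPrimitive.locallyIntegrable
      0 1).smul_continuousOn hw.continuous.continuousOn

/-- A test function with vanishing integral is the derivative of a test function. -/
theorem exists_deriv_eq {η : ℝ → ℝ} (h : IsTestFunction η) (h0 : ∫ x, η x = 0) :
    ∃ φ : ℝ → ℝ, IsTestFunction φ ∧ deriv φ = η := by
  rcases (tsupport η).eq_empty_or_nonempty with he | hne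
  · rw [tsupport_eq_empty_iff] at he
    exact ⟨η, h, by subst he; funext x; exact deriv_const x 0⟩
  obtain ⟨a, ha⟩ := h.hasCompactSupport.isCompact.exists_isLeast hne
  obtain ⟨b, hb⟩ := h.hasCompactSupport.isCompact.exists_isGreatest hne
  have ha1 := h.tsupport_subset ha.1
  have hb1 := h.tsupport_subset hb.1
  have hη : ∀ x, x ∉ Icc a b → η x = 0 := fun x hx =>
    image_eq_zero_of_notMem_tsupport fun h' => hx ⟨ha.2 h', hb.2 h'⟩
  have hd : ∀ x, HasDerivAt (fun x => ∫ y in (0 : ℝ)..x, η y) (η x) x := fun x =>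
    intervalIntegral.integral_hasDerivAt_right (h.continuous.intervalIntegrable _ _)
      (h.continuous.stronglyMeasurableAtFilter _ _) h.continuous.continuousAt
  have hderiv : deriv (fun x => ∫ y in (0 : ℝ)..x, η y) = η := funext fun x => (hd x).deriv
  have hsupp : tsupport (fun x => ∫ y in (0 : ℝ)..x, η y) ⊆ Icc a b := by
    refine closure_minimal (fun x hx => ?_) isClosed_Icc
    by_contra hx'
    refine hx ?_
    rcases lt_or_ge x a with hxa | hxa
    · refine (intervalIntegral.integral_congr (g := fun _ => (0 : ℝ))
        fun y hy => ?_).trans (by simp)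
      refine hη y fun hy' => ?_
      have := (mem_uIcc.1 hy)
      rcases this with h1 | h1 <;> linarith [hy'.1, ha1.1]
    · have hxb : b < x := by
        by_contra hc
        exact hx' ⟨hxa, not_lt.1 hc⟩
      refine (intervalIntegral.integral_eq_integral_of_support_subset fun y hy => ?_).trans h0
      have : y ∈ Icc a b := by
        by_contra hc
        exact hy (hη y hc)
      exact ⟨ha1.1.trans_le this.1, this.2.trans hxb.le⟩
  refine ⟨_, ⟨?_, ?_, ?_⟩, hderiv⟩
  · rw [contDiff_infty_iff_deriv]
    exact ⟨fun x => (hd x).differentiableAt, by rw [hderiv]; exact h.contDiff⟩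
  · exact isCompact_Icc.of_isClosed_subset (isClosed_tsupport _) hsupp
  · exact hsupp.trans fun x hx => ⟨ha1.1.trans_le hx.1, hx.2.trans_lt hb1.2⟩

theorem add {φ ψ : ℝ → F} (h : IsTestFunction φ) (h' : IsTestFunction ψ) :
    IsTestFunction (φ + ψ) := by
  refine ⟨h.contDiff.add h'.contDiff, h.hasCompactSupport.add h'.hasCompactSupport, ?_⟩
  exact (tsupport_add φ ψ).trans (union_subset h.tsupport_subset h'.tsupport_subset)

theorem smul {φ : ℝ → ℝ} (h : IsTestFunction φ) {ψ : ℝ → F}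
    (hψ : ContDiff ℝ ((⊤ : ℕ∞) : WithTop ℕ∞) ψ) : IsTestFunction (fun x => φ x • ψ x) := by
  refine ⟨h.contDiff.smul hψ, h.hasCompactSupport.smul_right, ?_⟩
  exact (tsupport_smul_subset_left φ ψ).trans h.tsupport_subset

end IsTestFunction

theorem _root_.ContDiffBump.isTestFunction (ρ : ContDiffBump (1 / 2 : ℝ)) (hρ : ρ.rOut < 1 / 2) :
    IsTestFunction (ρ : ℝ → ℝ) := by
  refine ⟨ρ.contDiff, ρ.hasCompactSupport, ?_⟩
  rw [ρ.tsupport_eq, Real.closedBall_eq_Icc]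
  exact fun x hx => ⟨by linarith [hx.1], by linarith [hx.2]⟩

/-- The du Bois-Reymond lemma: a continuous function with vanishing weak derivative is constant. -/
theorem eq_const_of_integral_deriv_smul_eq_zero [CompleteSpace F] {h : ℝ → F}
    (hc : ContinuousOn h (Icc 0 1))
    (h0 : ∀ φ : ℝ → ℝ, IsTestFunction φ → ∫ x in Icc (0 : ℝ) 1, deriv φ x • h x = 0) :
    ∃ c, ∀ x ∈ Icc (0 : ℝ) 1, h x = c := by
  -- Any test function differs from a multiple of one fixed test function of integral `1` by the
  -- derivative of a test function.
  obtain ⟨ρ, hρ, hρ1⟩ : ∃ ρ : ℝ → ℝ, IsTestFunction ρ ∧ ∫ x, ρ x = 1 := by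
    let b : ContDiffBump (1 / 2 : ℝ) := ⟨1 / 8, 1 / 4, by norm_num, by norm_num⟩
    have := (b.isTestFunction (by norm_num [b])).smul (ψ := fun _ => (∫ x, b x)⁻¹) contDiff_const
    refine ⟨_, this, ?_⟩
    simp only [smul_eq_mul]
    rw [integral_mul_const]
    exact mul_inv_cancel₀ b.integral_pos.ne'
  have hint : ∀ {φ : ℝ → ℝ}, Continuous φ → ∀ g : ℝ → F, ContinuousOn g (Icc 0 1) →
      IntegrableOn (fun x => φ x • g x) (Icc (0 : ℝ) 1) := fun hφ g hg =>
    (hφ.continuousOn.smul hg).integrableOn_compact isCompact_Icc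
  set c : F := ∫ x in Icc (0 : ℝ) 1, ρ x • h x with hcdef
  refine ⟨c, ?_⟩
  have key : ∀ᵐ x, x ∈ Ioo (0 : ℝ) 1 → h x - c = 0 := by
    refine isOpen_Ioo.ae_eq_zero_of_integral_contDiff_smul_eq_zero ?_ ?_
    · exact ((hc.mono Ioo_subset_Icc_self).sub continuousOn_const).locallyIntegrableOn
        measurableSet_Ioo
    · intro ψ hψ1 hψ2 hψ3
      have hψ : IsTestFunction ψ := ⟨hψ1, hψ2, hψ3⟩
      have hη : IsTestFunction (ψ + fun x => ρ x • (-∫ y, ψ y)) :=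
        hψ.add (hρ.smul contDiff_const)
      obtain ⟨φ, hφ, hφ'⟩ := hη.exists_deriv_eq (by
        simp only [Pi.add_apply, smul_eq_mul]
        rw [integral_add hψ.integrable (hρ.integrable.mul_const _), integral_mul_const, hρ1]
        ring)
      have h1 := h0 φ hφ
      rw [hφ'] at h1
      rw [← setIntegral_Icc_eq_integral fun x hx => by rw [hψ.eq_zero hx, zero_smul]]
      rw [← setIntegral_Icc_eq_integral fun x hx => hψ.eq_zero hx] at h1
      simp only [smul_sub]
      rw [integral_sub (hint hψ.continuous _ hc) (hint hψ.continuous _ continuousOn_const),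
        integral_smul_const, ← h1]
      generalize (∫ x in Icc (0 : ℝ) 1, ψ x) = m
      have h2 : ∫ x in Icc (0 : ℝ) 1, m • ρ x • h x = m • c := integral_smul m _
      rw [← h2, ← integral_sub (g := fun x => m • ρ x • h x) (hint hψ.continuous _ hc)
        (Integrable.smul m (hint hρ.continuous _ hc))]
      refine integral_congr_ae (.of_forall fun x => ?_)
      simp only [Pi.add_apply, smul_eq_mul, add_smul, mul_neg, neg_smul, sub_eq_add_neg, smul_smul,
        mul_comm]
  refine Measure.eqOn_Icc_of_ae_eq (g := fun _ => c) volume zero_ne_one ?_ hc continuousOn_const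
  rw [← restrict_Ioo_eq_restrict_Icc]
  rw [EventuallyEq, ae_restrict_iff' measurableSet_Ioo]
  filter_upwards [key] with x hx hx'
  exact sub_eq_zero.1 (hx hx')

end TestFunctions

/-! ### Windows of functions on the line -/

section Windows

variable {E : Type*} [Fintype E]

theorem memLp_indicator_coeFn (f : FlowSpace E) :
    MemLp (indicator (Ico (0 : ℝ) 1) f) 1 volume :=
  (memLp_indicator_iff_restrict measurableSet_Ico).2
    ((Lp.memLp f).mono_measure (Measure.restrict_mono Ico_subset_Icc_self le_rfl))

/-- Extension by zero, from `L¹([0,1], ℂ^E)` to `L¹(ℝ, ℂ^E)`. The half-open interval makes the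
integer translates of the support disjoint, so that exactly one passage number contributes at each
point. -/
noncomputable def zeroExt : FlowSpace E →L[ℂ] Lp (E → ℂ) 1 (volume : Measure ℝ) :=
  LinearMap.mkContinuous
    { toFun := fun f => (memLp_indicator_coeFn f).toLp
      map_add' := fun f g => by
        rw [← MemLp.toLp_add, MemLp.toLp_eq_toLp_iff]
        filter_upwards [(ae_restrict_iff' measurableSet_Icc).1 (Lp.coeFn_add f g)] with x hx
        by_cases h : x ∈ Ico (0 : ℝ) 1
        · simp only [indicator_of_mem h, Pi.add_apply]
          exact hx (Ico_subset_Icc_self h)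
        · simp [h]
      map_smul' := fun c f => by
        rw [RingHom.id_apply, ← MemLp.toLp_const_smul, MemLp.toLp_eq_toLp_iff]
        filter_upwards [(ae_restrict_iff' measurableSet_Icc).1 (Lp.coeFn_smul c f)] with x hx
        by_cases h : x ∈ Ico (0 : ℝ) 1
        · simp [h, hx (Ico_subset_Icc_self h)]
        · simp [h] } 1 fun f => by
    rw [one_mul, LinearMap.coe_mk, AddHom.coe_mk, Lp.norm_toLp, Lp.norm_def]
    refine ENNReal.toReal_mono (Lp.eLpNorm_ne_top f) ?_
    rw [eLpNorm_indicator_eq_eLpNorm_restrict measurableSet_Ico]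
    exact eLpNorm_mono_measure _ (Measure.restrict_mono Ico_subset_Icc_self le_rfl)

theorem zeroExt_ae (f : FlowSpace E) : zeroExt f =ᵐ[volume] indicator (Ico (0 : ℝ) 1) f :=
  MemLp.coeFn_toLp (memLp_indicator_coeFn f)

theorem norm_zeroExt_le (f : FlowSpace E) : ‖zeroExt f‖ ≤ ‖f‖ := by
  simpa using (zeroExt (E := E)).le_of_opNorm_le (LinearMap.mkContinuous_norm_le _ zero_le_one _) f

/-- The restriction of `g(t + ·)` to `[0,1]`, for `g` in `L¹(ℝ, ℂ^E)`. -/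
noncomputable def slide (t : ℝ) : Lp (E → ℂ) 1 (volume : Measure ℝ) →L[ℂ] FlowSpace E :=
  (LpToLpRestrictCLM ℝ (E → ℂ) ℂ volume 1 (Icc 0 1)).comp
    (Lp.compMeasurePreservingₗᵢ ℂ (fun x => t + x)
      (measurePreserving_add_left volume t)).toContinuousLinearMap

theorem slide_ae (t : ℝ) (g : Lp (E → ℂ) 1 (volume : Measure ℝ)) :
    slide t g =ᵐ[volume.restrict (Icc (0 : ℝ) 1)] fun x => g (t + x) :=
  (LpToLpRestrictCLM_coeFn ℂ _ _).trans
    (ae_restrict_of_ae (Lp.coeFn_compMeasurePreserving g (measurePreserving_add_left volume t)))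

theorem continuous_slide :
    Continuous fun p : ℝ × Lp (E → ℂ) 1 (volume : Measure ℝ) => slide p.1 p.2 := by
  let a : C(ℝ, C(ℝ, ℝ)) := (ContinuousMap.mk (fun p : ℝ × ℝ => p.1 + p.2) continuous_add).curry
  exact (LpToLpRestrictCLM ℝ (E → ℂ) ℂ volume 1 (Icc 0 1)).continuous.comp
    (Continuous.compMeasurePreservingLp
      (g := fun p : ℝ × Lp (E → ℂ) 1 (volume : Measure ℝ) => a p.1)
      continuous_snd (a.continuous.comp continuous_fst)
      (fun p => measurePreserving_add_left volume p.1) ENNReal.one_ne_top)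

theorem slide_zeroExt_ae (t : ℝ) (f : FlowSpace E) :
    slide t (zeroExt f) =ᵐ[volume.restrict (Icc (0 : ℝ) 1)]
      fun x => indicator (Ico (0 : ℝ) 1) f (t + x) :=
  (slide_ae t _).trans (ae_restrict_of_ae
    ((measurePreserving_add_left volume t).quasiMeasurePreserving.ae_eq_comp (zeroExt_ae f)))

theorem slide_zeroExt_eq_zero {t : ℝ} (ht : t ≤ -1) (f : FlowSpace E) :
    slide t (zeroExt f) = 0 := by
  refine Lp.ext ((slide_zeroExt_ae t f).trans ?_)
  have h1 : ∀ᵐ x ∂(volume.restrict (Icc (0 : ℝ) 1)), x ≠ 1 := by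
    refine ae_restrict_of_ae ?_
    simp [ae_iff, measure_singleton]
  filter_upwards [Lp.coeFn_zero (E → ℂ) 1 (volume.restrict (Icc (0 : ℝ) 1)), h1,
    ae_restrict_mem measurableSet_Icc] with x h0 hx hx'
  rw [h0, indicator_of_notMem]
  · rfl
  · intro h
    have := lt_of_le_of_ne hx'.2 hx
    linarith [h.1]

open Classical in
/-- The element `x ↦ w(t + x)` of `L¹([0,1], ℂ^E)`, for a locally integrable function `w` on
`ℝ` (and `0` if this function is not integrable on `[0,1]`). -/
noncomputable def window (w : ℝ → E → ℂ) (t : ℝ) : FlowSpace E :=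
  if h : IntegrableOn (fun x => w (t + x)) (Icc (0 : ℝ) 1) volume then h.toL1 else 0

theorem integrableOn_comp_add {w : ℝ → E → ℂ} (hw : LocallyIntegrable w volume) (t : ℝ) :
    IntegrableOn (fun x => w (t + x)) (Icc (0 : ℝ) 1) volume := by
  rw [integrableOn_Icc_iff_integrableOn_Ioc,
    ← intervalIntegrable_iff_integrableOn_Ioc_of_le zero_le_one]
  simpa using (intervalIntegrable_of_locallyIntegrable hw t (t + 1)).comp_add_left t

theorem window_ae {w : ℝ → E → ℂ} (hw : LocallyIntegrable w volume) (t : ℝ) :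
    window w t =ᵐ[volume.restrict (Icc (0 : ℝ) 1)] fun x => w (t + x) := by
  rw [window, dif_pos (integrableOn_comp_add hw t)]
  exact Integrable.coeFn_toL1 _

theorem continuous_window {w : ℝ → E → ℂ} (hw : LocallyIntegrable w volume) :
    Continuous (window w) := by
  refine continuous_iff_continuousAt.2 fun t₀ => ?_
  have hi : Integrable (indicator (Icc (t₀ - 1) (t₀ + 2)) w) volume :=
    (integrable_indicator_iff measurableSet_Icc).2 (hw.integrableOn_isCompact isCompact_Icc)
  obtain ⟨g, hg⟩ : ∃ g : Lp (E → ℂ) 1 (volume : Measure ℝ),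
      g =ᵐ[volume] indicator (Icc (t₀ - 1) (t₀ + 2)) w := ⟨_, hi.coeFn_toL1⟩
  have hc : Continuous fun t => slide t g :=
    continuous_slide.comp (g := fun p : ℝ × Lp (E → ℂ) 1 (volume : Measure ℝ) => slide p.1 p.2)
      (f := fun t => (t, g)) (continuous_id.prodMk continuous_const)
  refine hc.continuousAt.congr ?_
  filter_upwards [Ioo_mem_nhds (sub_one_lt t₀) (lt_add_one t₀)] with t ht
  refine Lp.ext ((slide_ae t _).trans (EventuallyEq.trans ?_ (window_ae hw t).symm))
  filter_upwards [ae_restrict_of_ae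
    ((measurePreserving_add_left volume t).quasiMeasurePreserving.ae_eq_comp hg),
    ae_restrict_mem measurableSet_Icc] with x hx hx'
  simp only [Function.comp_apply] at hx
  rw [hx, indicator_of_mem]
  exact ⟨by linarith [ht.1, hx'.1], by linarith [ht.2, hx'.2]⟩

/-! ### The partial integrals of an element of the state space -/

theorem intervalIntegrable_Lp (g : Lp (E → ℂ) 1 (volume : Measure ℝ)) (a b : ℝ) :
    IntervalIntegrable g volume a b :=
  (L1.integrable_coeFn g).intervalIntegrable

/-- The functional `f ↦ ∫₀ˣ f` on the state space, where `f` is extended by zero. -/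
noncomputable def partialInt (x : ℝ) : FlowSpace E →L[ℂ] (E → ℂ) :=
  LinearMap.mkContinuous
    { toFun := fun f => ∫ y in (0 : ℝ)..x, zeroExt f y
      map_add' := fun f g => by
        rw [map_add, ← intervalIntegral.integral_add (intervalIntegrable_Lp _ _ _)
          (intervalIntegrable_Lp _ _ _)]
        refine intervalIntegral.integral_congr_ae ?_
        filter_upwards [Lp.coeFn_add (zeroExt f) (zeroExt g)] with y hy _
        exact hy
      map_smul' := fun c f => by
        rw [map_smul, RingHom.id_apply, ← intervalIntegral.integral_smul]
        refine intervalIntegral.integral_congr_ae ?_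
        filter_upwards [Lp.coeFn_smul c (zeroExt f)] with y hy _
        exact hy } 1 fun f => by
    rw [one_mul, LinearMap.coe_mk, AddHom.coe_mk]
    refine le_trans ?_ (norm_zeroExt_le f)
    rw [L1.norm_eq_integral_norm]
    refine intervalIntegral.norm_integral_le_integral_norm_uIoc.trans ?_
    exact setIntegral_le_integral (L1.integrable_coeFn _).norm (.of_forall fun _ => norm_nonneg _)

theorem partialInt_apply (x : ℝ) (f : FlowSpace E) :
    partialInt x f = ∫ y in (0 : ℝ)..x, zeroExt f y := rfl

theorem norm_partialInt_le (x : ℝ) (f : FlowSpace E) : ‖partialInt x f‖ ≤ ‖f‖ := by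
  simpa using (partialInt (E := E) x).le_of_opNorm_le
    (LinearMap.mkContinuous_norm_le _ zero_le_one _) f

@[simp]
theorem partialInt_zero (f : FlowSpace E) : partialInt 0 f = 0 := by simp [partialInt_apply]

theorem isPrimitive_partialInt (f : FlowSpace E) :
    IsPrimitive (fun x => partialInt x f) (zeroExt f) := by
  refine ⟨(L1.integrable_coeFn _).locallyIntegrable, fun a b => ?_⟩
  exact intervalIntegral.integral_interval_sub_left (intervalIntegrable_Lp _ _ _)
    (intervalIntegrable_Lp _ _ _)

theorem ae_restrict_Icc_iff_Ioo {p : ℝ → Prop} :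
    (∀ᵐ x ∂(volume.restrict (Icc (0 : ℝ) 1)), p x) ↔ ∀ᵐ x, x ∈ Ioo (0 : ℝ) 1 → p x := by
  rw [← restrict_Ioo_eq_restrict_Icc, ae_restrict_iff' measurableSet_Ioo]

theorem zeroExt_ae_restrict (f : FlowSpace E) :
    zeroExt f =ᵐ[volume.restrict (Icc (0 : ℝ) 1)] f := by
  refine ae_restrict_Icc_iff_Ioo.2 ?_
  filter_upwards [zeroExt_ae f] with x hx hx'
  rw [hx, indicator_of_mem (Ioo_subset_Ico_self hx')]

/-- The partial integrals separate the points of the state space. -/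
theorem eq_zero_of_partialInt_eq_zero {f : FlowSpace E}
    (h : ∀ x ∈ Icc (0 : ℝ) 1, partialInt x f = 0) : f = 0 := by
  refine Lp.ext ?_
  filter_upwards [zeroExt_ae_restrict f, ae_restrict_Icc_iff_Ioo.2
    ((isPrimitive_partialInt f).ae_hasDerivAt.mono fun x hx (_ : x ∈ Ioo (0 : ℝ) 1) => hx),
    (ae_restrict_Icc_iff_Ioo (p := fun x => x ∈ Ioo (0 : ℝ) 1)).2 (.of_forall fun _ hx => hx),
    Lp.coeFn_zero (E → ℂ) 1 (volume.restrict (Icc (0 : ℝ) 1))] with x h1 h2 h3 h4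
  rw [h4, ← h1]
  refine h2.unique ((hasDerivAt_const x (0 : E → ℂ)).congr_of_eventuallyEq ?_)
  filter_upwards [Ioo_mem_nhds h3.1 h3.2] with y hy
  exact h y (Ioo_subset_Icc_self hy)

theorem partialInt_eq_of_ae {x : ℝ} (hx : x ∈ Icc (0 : ℝ) 1) {f : FlowSpace E} {F : ℝ → E → ℂ}
    (hF : f =ᵐ[volume.restrict (Icc (0 : ℝ) 1)] F) : partialInt x f = ∫ y in (0 : ℝ)..x, F y := by
  refine intervalIntegral.integral_congr_ae ?_
  have := ae_restrict_Icc_iff_Ioo.1 ((zeroExt_ae_restrict f).trans hF)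
  have h1 : ∀ᵐ y : ℝ, y ≠ 1 := by simp [ae_iff, measure_singleton]
  filter_upwards [this, h1] with y hy hy1 hy'
  rw [uIoc_of_le hx.1] at hy'
  exact hy ⟨hy'.1, lt_of_le_of_ne (hy'.2.trans hx.2) hy1⟩

theorem partialInt_window {w : ℝ → E → ℂ} (hw : LocallyIntegrable w volume) (t : ℝ) {x : ℝ}
    (hx : x ∈ Icc (0 : ℝ) 1) : partialInt x (window w t) = ∫ y in t..t + x, w y := by
  rw [partialInt_eq_of_ae hx (window_ae hw t), intervalIntegral.integral_comp_add_left]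
  simp

/-- The windows of an absolutely continuous function are continuously differentiable in time, and
the derivative is the window of the density. -/
theorem hasDerivAt_window {w w' : ℝ → E → ℂ} (h : IsPrimitive w w') (t : ℝ) :
    HasDerivAt (window w) (window w' t) t := by
  have hw := h.continuous.locallyIntegrable (μ := volume)
  have hc := continuous_window h.locallyIntegrable
  have hd : ∀ t, HasDerivAt (fun t => ∫ r in (0 : ℝ)..t, window w' r) (window w' t) t := fun t =>
    intervalIntegral.integral_hasDerivAt_right (hc.intervalIntegrable _ _)
      (hc.stronglyMeasurableAtFilter _ _) hc.continuousAt
  -- Tested against the partial integrals, the two sides of the fundamental theorem of calculus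
  -- have the same derivative, as `w` is continuous.
  have key : ∀ t, window w t = window w 0 + ∫ r in (0 : ℝ)..t, window w' r := by
    intro t
    rw [← sub_eq_zero]
    refine eq_zero_of_partialInt_eq_zero fun x hx => ?_
    have hx1 : ∀ r, HasDerivAt (fun r => partialInt x (window w r))
        (partialInt x (window w' r)) r := by
      intro r
      simp only [partialInt_window hw _ hx, partialInt_window h.locallyIntegrable _ hx]
      rw [← h.sub_eq]
      have h1 : ∀ r, HasDerivAt (fun r => ∫ y in (0 : ℝ)..r, w y) (w r) r := fun r =>
        intervalIntegral.integral_hasDerivAt_right (h.continuous.intervalIntegrable _ _)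
          (h.continuous.stronglyMeasurableAtFilter _ _) h.continuous.continuousAt
      have h2 := ((h1 (r + x)).comp_add_const r x).sub (h1 r)
      refine h2.congr_of_eventuallyEq (.of_forall fun r => ?_)
      exact (intervalIntegral.integral_interval_sub_left (h.continuous.intervalIntegrable _ _)
        (h.continuous.intervalIntegrable _ _)).symm
    have hx2 : ∀ r, HasDerivAt (fun r => partialInt x (window w r) -
        partialInt x (∫ r in (0 : ℝ)..r, window w' r)) 0 r := by
      intro r
      have := (hx1 r).sub
        (((partialInt (E := E) x).restrictScalars ℝ).hasFDerivAt.comp_hasDerivAt r (hd r))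
      rw [← sub_self (partialInt x (window w' r))]
      exact this
    have h3 := is_const_of_deriv_eq_zero (fun r => (hx2 r).differentiableAt)
      (fun r => (hx2 r).deriv) t 0
    simp only [intervalIntegral.integral_same, map_zero, sub_zero] at h3
    rw [map_sub, map_add, ← h3]
    abel
  rw [funext key]
  exact (hd t).const_add _

end Windows

/-! ### Weak derivatives in the state space -/

section WeakDeriv

variable {E : Type*} [Fintype E]

theorem isWeakDeriv_window {w w' : ℝ → E → ℂ} (h : IsPrimitive w w') (t : ℝ) :
    IsWeakDeriv (window w t) (window w' t) := by
  intro φ h1 h2 h3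
  have hw : IsPrimitive (fun x => w (t + x)) (fun x => w' (t + x)) := by
    simpa only [add_comm] using h.comp_add_right t
  have := IsTestFunction.integral_deriv_smul ⟨h1, h2, h3⟩ hw
  rw [integral_congr_ae ((window_ae h.continuous.locallyIntegrable t).mono fun x hx =>
      congrArg (deriv φ x • ·) hx),
    integral_congr_ae ((window_ae h.locallyIntegrable t).mono fun x hx => congrArg (φ x • ·) hx)]
  exact this

theorem hasTraces_window {w : ℝ → E → ℂ} (hw : Continuous w) (t : ℝ) :
    HasTraces (window w t) (w t) (w (t + 1)) :=
  ⟨fun x => w (t + x), (hw.comp (continuous_const.add continuous_id)).continuousOn,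
    window_ae hw.locallyIntegrable t, by simp, rfl⟩

/-- A continuous representative of a weakly differentiable element is a primitive of its weak
derivative. -/
theorem eq_add_partialInt_of_isWeakDeriv {f g : FlowSpace E} (h : IsWeakDeriv f g)
    {F : ℝ → E → ℂ} (hc : ContinuousOn F (Icc 0 1))
    (hF : f =ᵐ[volume.restrict (Icc (0 : ℝ) 1)] F) {x : ℝ} (hx : x ∈ Icc (0 : ℝ) 1) :
    F x = F 0 + partialInt x g := by
  have hp := isPrimitive_partialInt g
  have hint : ∀ {φ : ℝ → ℝ}, Continuous φ → ∀ u : ℝ → E → ℂ, ContinuousOn u (Icc 0 1) →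
      IntegrableOn (fun x => φ x • u x) (Icc (0 : ℝ) 1) := fun hφ u hu =>
    (hφ.continuousOn.smul hu).integrableOn_compact isCompact_Icc
  obtain ⟨c, hc⟩ := eq_const_of_integral_deriv_smul_eq_zero
    (hc.sub hp.continuous.continuousOn) fun φ hφ => by
      have h1 := h φ hφ.contDiff hφ.hasCompactSupport hφ.tsupport_subset
      have h2 := hφ.integral_deriv_smul hp
      have hd : Continuous (deriv φ) := (hφ.contDiff.of_le (m := 1)
        (by exact_mod_cast le_top)).continuous_deriv le_rfl
      simp only [Pi.sub_apply, smul_sub]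
      rw [integral_sub (hint hd _ hc) (hint hd _ hp.continuous.continuousOn), h2,
        ← integral_congr_ae (hF.mono fun x hx => congrArg (deriv φ x • ·) hx), h1,
        integral_congr_ae ((zeroExt_ae_restrict g).mono fun x hx => congrArg (φ x • ·) hx),
        sub_self]
  have h1 := hc x hx
  have h2 := hc 0 (by simp)
  simp only [Pi.sub_apply, partialInt_zero, sub_zero] at h1 h2
  rw [h2, ← h1]
  abel

/-- The test functions on `(0,1)` are dense in `L¹([0,1], ℂ^E)`. -/
theorem dense_testFunctions :
    Dense {f : FlowSpace E | ∃ φ : ℝ → E → ℂ, IsTestFunction φ ∧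
      f =ᵐ[volume.restrict (Icc (0 : ℝ) 1)] φ} := by
  refine Dense.of_closure ((MeasureTheory.Lp.dense_hasCompactSupport_contDiff
    (F := E → ℂ) (μ := volume.restrict (Icc (0 : ℝ) 1)) ENNReal.one_ne_top).mono ?_)
  rintro f ⟨ψ, hfψ, hψs, hψ⟩
  rw [Metric.mem_closure_iff]
  intro ε hε
  obtain ⟨C, hC⟩ := hψs.exists_bound_of_continuous hψ.continuous
  have hC0 : 0 ≤ C := (norm_nonneg _).trans (hC 0)
  -- Cut `ψ` off within the distance `2 * δ` from the endpoints.
  obtain ⟨δ, hδ0, hδ1, hδ⟩ : ∃ δ : ℝ, 0 < δ ∧ δ < 1 / 4 ∧ C * (4 * δ) < ε := by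
    refine ⟨min (1 / 8) (ε / (8 * (C + 1))), by positivity,
      (min_le_left _ _).trans_lt (by norm_num), ?_⟩
    have h1 : min (1 / 8) (ε / (8 * (C + 1))) ≤ ε / (8 * (C + 1)) := min_le_right _ _
    calc C * (4 * min (1 / 8) (ε / (8 * (C + 1)))) ≤ C * (4 * (ε / (8 * (C + 1)))) := by gcongr
      _ = (C / (C + 1)) * (ε / 2) := by field_simp; ring
      _ ≤ 1 * (ε / 2) := by
        gcongr
        rw [div_le_one (by positivity)]
        linarith
      _ < ε := by linarith
  let χ : ContDiffBump (1 / 2 : ℝ) :=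
    ⟨1 / 2 - 2 * δ, 1 / 2 - δ, by linarith, by linarith⟩
  have hχ : IsTestFunction (χ : ℝ → ℝ) := χ.isTestFunction (by simp only [χ]; linarith)
  have hφ := hχ.smul hψ
  have hφi : Integrable (fun x => χ x • ψ x) (volume.restrict (Icc (0 : ℝ) 1)) :=
    hφ.integrable.restrict
  refine ⟨hφi.toL1, ⟨_, hφ, hφi.coeFn_toL1⟩, ?_⟩
  have hone : Integrable (fun x => 1 - χ x) (volume.restrict (Icc (0 : ℝ) 1)) :=
    (continuous_const.sub hχ.continuous).continuousOn.integrableOn_compact isCompact_Icc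
  have hmass : ∫ x in Icc (0 : ℝ) 1, (1 - χ x) ≤ 4 * δ := by
    have h1 : ∫ x in Icc (2 * δ) (1 - 2 * δ), χ x = 1 - 4 * δ := by
      rw [setIntegral_congr_fun measurableSet_Icc (g := fun _ => (1 : ℝ))]
      · simp only [integral_const, MeasurableSet.univ, measureReal_restrict_apply, univ_inter,
          Real.volume_real_Icc, smul_eq_mul, mul_one]
        rw [max_eq_left (by linarith)]
        ring
      · intro x hx
        refine χ.one_of_mem_closedBall ?_
        rw [Real.closedBall_eq_Icc]
        exact ⟨by simp only [χ]; linarith [hx.1], by simp only [χ]; linarith [hx.2]⟩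
    have h2 : ∫ x in Icc (2 * δ) (1 - 2 * δ), χ x ≤ ∫ x in Icc (0 : ℝ) 1, χ x :=
      setIntegral_mono_set hχ.integrable.integrableOn (.of_forall fun x => χ.nonneg)
        (Icc_subset_Icc (by linarith) (by linarith)).eventuallyLE
    rw [integral_sub (integrable_const _) hχ.integrable.restrict]
    simp only [integral_const, MeasurableSet.univ, measureReal_restrict_apply, univ_inter,
      Real.volume_real_Icc, sub_zero, zero_le_one, sup_of_le_left, smul_eq_mul, mul_one]
    linarith
  rw [dist_eq_norm, L1.norm_eq_integral_norm]
  calc ∫ x in Icc (0 : ℝ) 1, ‖(f - hφi.toL1 : FlowSpace E) x‖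
      ≤ ∫ x in Icc (0 : ℝ) 1, C * (1 - χ x) := by
        refine integral_mono_ae (L1.integrable_coeFn _).norm (hone.const_mul C) ?_
        filter_upwards [Lp.coeFn_sub f hφi.toL1, hfψ, hφi.coeFn_toL1] with x h1 h2 h3
        rw [h1, Pi.sub_apply, h2, h3]
        have : ψ x - χ x • ψ x = (1 - χ x) • ψ x := by rw [sub_smul, one_smul]
        rw [this, norm_smul, Real.norm_of_nonneg (sub_nonneg.2 χ.le_one), mul_comm]
        exact mul_le_mul_of_nonneg_right (hC x) (sub_nonneg.2 χ.le_one)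
    _ = C * ∫ x in Icc (0 : ℝ) 1, (1 - χ x) := integral_const_mul _ _
    _ ≤ C * (4 * δ) := by gcongr
    _ < ε := hδ

end WeakDeriv

/-! ### The evolution family -/

section Evolution

variable {E : Type*} [Fintype E]

/-- The product `B(τ - 1) B(τ - 2) ⋯ B(τ - k)`, by which the values of the flow are multiplied
along a characteristic that passes `k` times through the vertices before time `τ`. -/
noncomputable def propagator (B : C(ℝ, (E → ℂ) →L[ℂ] (E → ℂ))) :
    ℕ → ℝ → (E → ℂ) →L[ℂ] (E → ℂ)
  | 0, _ => ContinuousLinearMap.id ℂ (E → ℂ)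
  | k + 1, τ => (B (τ - 1)).comp (propagator B k (τ - 1))

variable (B : C(ℝ, (E → ℂ) →L[ℂ] (E → ℂ)))

theorem continuous_propagator (k : ℕ) : Continuous (propagator B k) := by
  induction k with
  | zero => exact continuous_const
  | succ k ih =>
    have h : Continuous fun τ : ℝ => τ - 1 := continuous_id.sub continuous_const
    exact (B.continuous.comp h).clm_comp (ih.comp h)

variable {B} in
omit [Fintype E] in
theorem propagator_apply_of_recursion {s : ℝ} {g : ℝ → E → ℂ}
    (hg : ∀ τ, s ≤ τ → g (τ + 1) = B τ (g τ)) (k : ℕ) {τ : ℝ} (hτ : s ≤ τ - k) :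
    propagator B k τ (g (τ - k)) = g τ := by
  induction k generalizing τ with
  | zero => simp [propagator]
  | succ k ih =>
    push_cast at hτ ⊢
    have h1 : s ≤ τ - 1 := by
      have : (0 : ℝ) ≤ k := k.cast_nonneg
      linarith
    rw [propagator, ContinuousLinearMap.comp_apply, show τ - (k + 1 : ℝ) = τ - 1 - k by ring,
      ih (by linarith), ← hg _ h1, sub_add_cancel]

theorem norm_pointwise_le (q : C(Icc (0 : ℝ) 1, (E → ℂ) →L[ℂ] (E → ℂ))) (f : FlowSpace E) (x : ℝ) :
    ‖q (projIcc 0 1 zero_le_one x) (f x)‖ ≤ ‖q‖ * ‖f x‖ :=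
  ContinuousLinearMap.le_of_opNorm_le _ (q.norm_coe_le_norm _) _

theorem integrable_pointwise (q : C(Icc (0 : ℝ) 1, (E → ℂ) →L[ℂ] (E → ℂ))) (f : FlowSpace E) :
    Integrable (fun x => q (projIcc 0 1 zero_le_one x) (f x)) (volume.restrict (Icc (0 : ℝ) 1)) :=
  ((L1.integrable_coeFn f).norm.const_mul ‖q‖).mono'
    (isBoundedBilinearMap_apply.continuous.comp_aestronglyMeasurable
      ((q.continuous.comp continuous_projIcc).aestronglyMeasurable.prodMk
        (L1.integrable_coeFn f).aestronglyMeasurable)) (.of_forall (norm_pointwise_le q f))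

/-- Pointwise application of a continuous operator-valued function on `[0,1]`. The elements of the
state space are represented by functions on `ℝ`, so the operators are extended constantly to `ℝ`. -/
noncomputable def pointwiseOp : C(Icc (0 : ℝ) 1, (E → ℂ) →L[ℂ] (E → ℂ)) →L[ℂ]
    FlowSpace E →L[ℂ] FlowSpace E :=
  LinearMap.mkContinuous₂
    (LinearMap.mk₂ ℂ (fun (q : C(Icc (0 : ℝ) 1, (E → ℂ) →L[ℂ] (E → ℂ))) (f : FlowSpace E) =>
      (integrable_pointwise q f).toL1)
      (fun q q' f => by
        rw [← Integrable.toL1_add, Integrable.toL1_eq_toL1_iff]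
        exact .of_forall fun x => rfl)
      (fun c q f => by
        rw [← Integrable.toL1_smul, Integrable.toL1_eq_toL1_iff]
        exact .of_forall fun x => rfl)
      (fun q f f' => by
        rw [← Integrable.toL1_add, Integrable.toL1_eq_toL1_iff]
        filter_upwards [Lp.coeFn_add f f'] with x hx
        rw [hx, Pi.add_apply, map_add]
        rfl)
      (fun c q f => by
        rw [← Integrable.toL1_smul, Integrable.toL1_eq_toL1_iff]
        filter_upwards [Lp.coeFn_smul c f] with x hx
        rw [hx, Pi.smul_apply, map_smul])) 1 fun q f => by
    rw [one_mul, LinearMap.mk₂_apply, L1.norm_eq_integral_norm, L1.norm_eq_integral_norm,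
      ← integral_const_mul]
    refine integral_mono_ae (L1.integrable_coeFn _).norm
      ((L1.integrable_coeFn f).norm.const_mul ‖q‖) ?_
    filter_upwards [(integrable_pointwise q f).coeFn_toL1] with x hx
    rw [hx]
    exact norm_pointwise_le q f x

theorem pointwiseOp_ae (q : C(Icc (0 : ℝ) 1, (E → ℂ) →L[ℂ] (E → ℂ))) (f : FlowSpace E) :
    pointwiseOp q f =ᵐ[volume.restrict (Icc (0 : ℝ) 1)]
      fun x => q (projIcc 0 1 zero_le_one x) (f x) :=
  (integrable_pointwise q f).coeFn_toL1

/-- The restriction of `propagator B k (t + ·)` to `[0,1]`, as a continuous function of `t`. -/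
noncomputable def propagatorWindow (k : ℕ) :
    C(ℝ, C(Icc (0 : ℝ) 1, (E → ℂ) →L[ℂ] (E → ℂ))) :=
  ContinuousMap.curry ⟨fun p : ℝ × Icc (0 : ℝ) 1 => propagator B k (p.1 + p.2),
    (continuous_propagator B k).comp
      (continuous_fst.add (continuous_subtype_val.comp continuous_snd))⟩

/-- The part of the flow from time `s` to time `t` that has passed exactly `k` times through the
vertices. -/
noncomputable def passageOp (t s : ℝ) (k : ℕ) : FlowSpace E →L[ℂ] FlowSpace E :=
  (pointwiseOp (propagatorWindow B k t)).comp ((slide (t - s - k)).comp zeroExt)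

/-- The evolution family of the flow `u_t = u_x` with the boundary condition
`u(1,t) = B(t) u(0,t)`. All passage numbers beyond the range of the sum contribute `0`. -/
noncomputable def flowEvolution (t s : ℝ) : FlowSpace E →L[ℂ] FlowSpace E :=
  ∑ k ∈ Finset.range (⌊t - s⌋₊ + 2), passageOp B t s k

theorem passageOp_ae (t s : ℝ) (k : ℕ) (f : FlowSpace E) :
    passageOp B t s k f =ᵐ[volume.restrict (Icc (0 : ℝ) 1)]
      fun x => propagator B k (t + x) (indicator (Ico (0 : ℝ) 1) f (t - s - k + x)) := by
  refine (pointwiseOp_ae (propagatorWindow B k t) (slide (t - s - k) (zeroExt f))).trans ?_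
  filter_upwards [slide_zeroExt_ae (t - s - k) f, ae_restrict_mem measurableSet_Icc] with x h1 h2
  rw [h1, projIcc_of_mem _ h2]
  rfl

theorem passageOp_eq_zero {t s : ℝ} {k : ℕ} (hk : t - s + 1 ≤ k) : passageOp B t s k = 0 := by
  ext1 f
  rw [passageOp, ContinuousLinearMap.comp_apply, ContinuousLinearMap.comp_apply,
    slide_zeroExt_eq_zero (by linarith), map_zero]
  rfl

theorem flowEvolution_eq_sum {t s : ℝ} {N : ℕ} (hN : ⌊t - s⌋₊ + 2 ≤ N) :
    flowEvolution B t s = ∑ k ∈ Finset.range N, passageOp B t s k := by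
  refine Finset.sum_subset (Finset.range_mono hN) fun k _ hk => passageOp_eq_zero B ?_
  rw [Finset.mem_range, not_lt] at hk
  have h1 := Nat.lt_floor_add_one (t - s)
  have h2 : ((⌊t - s⌋₊ + 2 : ℕ) : ℝ) ≤ k := by exact_mod_cast hk
  push_cast at h2
  linarith

theorem flowEvolution_ae_sum {t s : ℝ} {N : ℕ} (hN : ⌊t - s⌋₊ + 2 ≤ N) (f : FlowSpace E) :
    flowEvolution B t s f =ᵐ[volume.restrict (Icc (0 : ℝ) 1)] fun x =>
      ∑ k ∈ Finset.range N,
        propagator B k (t + x) (indicator (Ico (0 : ℝ) 1) f (t - s - k + x)) := by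
  rw [flowEvolution_eq_sum B hN, _root_.sum_apply]
  filter_upwards [Lp.coeFn_fun_finsetSum (Finset.range N) fun k => passageOp B t s k f,
    ae_all_iff.2 fun k => passageOp_ae B t s k f] with x h1 h2
  rw [h1]
  exact Finset.sum_congr rfl fun k _ => h2 k

/-- The evolution family along the characteristics. -/
theorem flowEvolution_ae (t s : ℝ) (f : FlowSpace E) :
    ∀ᵐ x ∂(volume.restrict (Icc (0 : ℝ) 1)), ∀ k : ℕ, (k : ℝ) ≤ x + t - s → x + t - s < k + 1 →
      flowEvolution B t s f x = propagator B k (t + x) (f (x + t - s - k)) := by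
  filter_upwards [flowEvolution_ae_sum B le_rfl f, ae_restrict_mem measurableSet_Icc]
    with x h1 hx k hk1 hk2
  rw [h1, Finset.sum_eq_single k]
  · rw [show t - s - k + x = x + t - s - k by ring, indicator_of_mem]
    exact ⟨by linarith, by linarith⟩
  · intro j _ hj
    rw [indicator_of_notMem, map_zero]
    rintro ⟨h2, h3⟩
    apply hj
    have h4 : (j : ℝ) < k + 1 := by linarith
    have h5 : (k : ℝ) < j + 1 := by linarith
    have h4' : j < k + 1 := by exact_mod_cast h4
    have h5' : k < j + 1 := by exact_mod_cast h5
    omega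
  · intro hk
    exfalso
    rw [Finset.mem_range, not_lt] at hk
    have h2 : ((⌊t - s⌋₊ + 2 : ℕ) : ℝ) ≤ k := by exact_mod_cast hk
    have h3 := Nat.lt_floor_add_one (t - s)
    push_cast at h2
    linarith [hx.2]

variable {B} in
/-- A function on `[s, ∞)` with `g(τ + 1) = B(τ) g(τ)` is transported by the evolution family. No
regularity of `g` is needed. -/
theorem flowEvolution_ae_of_recursion {s t : ℝ} (hst : s ≤ t) {g : ℝ → E → ℂ}
    (hg : ∀ τ, s ≤ τ → g (τ + 1) = B τ (g τ)) {f : FlowSpace E}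
    (hf : f =ᵐ[volume.restrict (Icc (0 : ℝ) 1)] fun x => g (s + x)) :
    flowEvolution B t s f =ᵐ[volume.restrict (Icc (0 : ℝ) 1)] fun x => g (t + x) := by
  have h1 : ∀ k : ℕ, ∀ᵐ x : ℝ, (t - s - k) + x ∈ Icc (0 : ℝ) 1 →
      f ((t - s - k) + x) = g (s + ((t - s - k) + x)) := fun k =>
    (measurePreserving_add_left volume (t - s - k)).quasiMeasurePreserving.ae
      ((ae_restrict_iff' measurableSet_Icc).1 hf)
  filter_upwards [flowEvolution_ae B t s f, ae_restrict_of_ae (ae_all_iff.2 h1),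
    ae_restrict_mem measurableSet_Icc] with x h2 h3 hx
  have h4 : 0 ≤ x + t - s := by linarith [hx.1]
  have h5 := Nat.floor_le h4
  have h6 := Nat.lt_floor_add_one (x + t - s)
  rw [h2 ⌊x + t - s⌋₊ h5 h6]
  have h7 := h3 ⌊x + t - s⌋₊ ⟨by linarith, by linarith⟩
  rw [show t - s - ⌊x + t - s⌋₊ + x = x + t - s - ⌊x + t - s⌋₊ by ring,
    show s + (x + t - s - ⌊x + t - s⌋₊) = t + x - ⌊x + t - s⌋₊ by ring] at h7
  rw [h7]
  exact propagator_apply_of_recursion hg _ (by linarith)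

/-- Every element of the state space is the initial value of a function `g` on `[s, ∞)` with
`g(τ + 1) = B(τ) g(τ)`. -/
theorem exists_recursion (s : ℝ) (f : FlowSpace E) :
    ∃ g : ℝ → E → ℂ, (∀ τ, s ≤ τ → g (τ + 1) = B τ (g τ)) ∧
      f =ᵐ[volume.restrict (Icc (0 : ℝ) 1)] fun x => g (s + x) := by
  refine ⟨fun τ => propagator B ⌊τ - s⌋₊ τ (f (τ - s - ⌊τ - s⌋₊)), fun τ hτ => ?_, ?_⟩
  · have h1 : ⌊τ + 1 - s⌋₊ = ⌊τ - s⌋₊ + 1 := by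
      rw [show τ + 1 - s = τ - s + 1 by ring, Nat.floor_add_one (by linarith)]
    simp only [h1, propagator, ContinuousLinearMap.comp_apply, add_sub_cancel_right]
    push_cast
    rw [show τ + 1 - s - (⌊τ - s⌋₊ + 1 : ℝ) = τ - s - ⌊τ - s⌋₊ by ring]
  · refine ae_restrict_Icc_iff_Ioo.2 (.of_forall fun x hx => ?_)
    simp only [add_sub_cancel_left, Nat.floor_eq_zero.2 hx.2, CharP.cast_eq_zero, sub_zero]
    rfl

theorem isEvolutionFamily_flowEvolution : IsEvolutionFamily (flowEvolution B) where
  refl s := by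
    ext1 f
    obtain ⟨g, hg, hf⟩ := exists_recursion B s f
    exact Lp.ext ((flowEvolution_ae_of_recursion le_rfl hg hf).trans hf.symm)
  comp t r s hsr hrt := by
    ext1 f
    obtain ⟨g, hg, hf⟩ := exists_recursion B s f
    exact Lp.ext ((flowEvolution_ae_of_recursion (hsr.trans hrt) hg hf).trans
      (flowEvolution_ae_of_recursion hrt (fun τ hτ => hg τ (hsr.trans hτ))
        (flowEvolution_ae_of_recursion hsr hg hf)).symm)
  cont f := by
    refine Continuous.continuousOn (continuous_iff_continuousAt.2 fun p₀ => ?_)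
    have hc : Continuous fun p : ℝ × ℝ =>
        ∑ k ∈ Finset.range (⌊p₀.1 - p₀.2 + 1⌋₊ + 2), passageOp B p.1 p.2 k f := by
      refine continuous_finsetSum _ fun k _ => ?_
      refine Continuous.clm_apply
        (f := fun p : ℝ × ℝ => pointwiseOp (propagatorWindow B k p.1))
        (pointwiseOp.continuous.comp ((propagatorWindow B k).continuous.comp continuous_fst)) ?_
      exact continuous_slide.comp
        (g := fun p : ℝ × Lp (E → ℂ) 1 (volume : Measure ℝ) => slide p.1 p.2)
        (f := fun p : ℝ × ℝ => (p.1 - p.2 - k, zeroExt f))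
        (((continuous_fst.sub continuous_snd).sub continuous_const).prodMk continuous_const)
    refine hc.continuousAt.congr ?_
    have ho : ∀ᶠ p : ℝ × ℝ in 𝓝 p₀, p.1 - p.2 < p₀.1 - p₀.2 + 1 :=
      (continuous_fst.sub continuous_snd).continuousAt.eventually_lt_const (lt_add_one _)
    filter_upwards [ho] with p hp
    have hN : ⌊p.1 - p.2⌋₊ + 2 ≤ ⌊p₀.1 - p₀.2 + 1⌋₊ + 2 := by
      gcongr
    rw [flowEvolution_eq_sum B hN, _root_.sum_apply]

/-! ### Regular initial values -/

variable {B} in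
theorem exists_isPrimitive_propagator
    (hB : ∀ v v' : ℝ → E → ℂ, IsPrimitive v v' → ∃ u', IsPrimitive (fun τ => B τ (v τ)) u')
    (k : ℕ) {v v' : ℝ → E → ℂ} (hv : IsPrimitive v v') :
    ∃ u', IsPrimitive (fun τ => propagator B k τ (v τ)) u' := by
  induction k generalizing v v' with
  | zero => exact ⟨v', hv⟩
  | succ k ih =>
    obtain ⟨u₁, h₁⟩ := ih (hv.comp_add_right 1)
    obtain ⟨u₂, h₂⟩ := hB _ _ h₁
    have := h₂.comp_add_right (-1)
    simp only [← sub_eq_add_neg, sub_add_cancel] at this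
    exact ⟨_, this⟩

/-- The first `N` passages of the flow that starts at time `s` with the test function `φ`, as a
function along the characteristics. -/
noncomputable def passageSum (s : ℝ) (φ : ℝ → E → ℂ) (N : ℕ) (τ : ℝ) : E → ℂ :=
  ∑ k ∈ Finset.range N, propagator B k τ (φ (τ - s - k))

theorem passageSum_add_one {s : ℝ} {φ : ℝ → E → ℂ} (hφ : IsTestFunction φ) {N : ℕ} {τ : ℝ}
    (hτ : s ≤ τ) (hN : τ - s ≤ N) :
    passageSum B s φ (N + 1) (τ + 1) = B τ (passageSum B s φ (N + 1) τ) := by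
  have h0 : φ (τ + 1 - s - (0 : ℕ)) = 0 := hφ.eq_zero fun h => by
    have := h.2
    simp only [CharP.cast_eq_zero, sub_zero] at this
    linarith
  have hlast : φ (τ - s - N) = 0 := hφ.eq_zero fun h => by linarith [h.1]
  rw [passageSum, Finset.sum_range_succ', h0, map_zero, add_zero, passageSum,
    Finset.sum_range_succ, hlast, map_zero, add_zero, map_sum]
  refine Finset.sum_congr rfl fun k _ => ?_
  rw [propagator, ContinuousLinearMap.comp_apply, add_sub_cancel_right]
  push_cast
  rw [show τ + 1 - s - (k + 1 : ℝ) = τ - s - k by ring]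

variable {B} in
/-- The evolution family yields classical solutions for all test functions as initial values. -/
theorem isClassicalSolution_flowEvolution
    (hB : ∀ v v' : ℝ → E → ℂ, IsPrimitive v v' → ∃ u', IsPrimitive (fun τ => B τ (v τ)) u')
    (s : ℝ) {f : FlowSpace E} {φ : ℝ → E → ℂ} (hφ : IsTestFunction φ)
    (hf : f =ᵐ[volume.restrict (Icc (0 : ℝ) 1)] φ) :
    IsClassicalSolution (fun t => BoundaryDerivOp fun a b => b = B t a) s
      fun t => flowEvolution B t s f := by
  have hf' : indicator (Ico (0 : ℝ) 1) f =ᵐ[volume] φ := by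
    filter_upwards [(ae_restrict_iff' measurableSet_Icc).1 hf] with x hx
    by_cases h : x ∈ Ico (0 : ℝ) 1
    · rw [indicator_of_mem h, hx (Ico_subset_Icc_self h)]
    · rw [indicator_of_notMem h, hφ.eq_zero fun h' => h (Ioo_subset_Ico_self h')]
  have hprim : ∀ N, ∃ w', IsPrimitive (passageSum B s φ N) w' := by
    intro N
    have h1 : ∀ k : ℕ, ∃ u', IsPrimitive (fun τ => propagator B k τ (φ (τ - s - k))) u' := by
      intro k
      have := hφ.isPrimitive.comp_add_right (-(s + k))
      obtain ⟨u', hu⟩ := exists_isPrimitive_propagator hB k this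
      refine ⟨u', ?_⟩
      convert hu using 5
      ring
    choose u hu using h1
    exact ⟨_, IsPrimitive.sum _ fun k _ => hu k⟩
  choose w' hw' using hprim
  have heq : ∀ N t, ⌊t - s⌋₊ + 2 ≤ N → flowEvolution B t s f = window (passageSum B s φ N) t := by
    intro N t hN
    refine Lp.ext ((flowEvolution_ae_sum B hN f).trans (EventuallyEq.trans ?_
      (window_ae (hw' N).continuous.locallyIntegrable t).symm))
    filter_upwards [ae_restrict_of_ae (ae_all_iff.2 fun k : ℕ =>
      (measurePreserving_add_left volume (t - s - k)).quasiMeasurePreserving.ae_eq_comp hf')]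
      with x hx
    refine Finset.sum_congr rfl fun k _ => ?_
    have := hx k
    simp only [Function.comp_apply] at this
    rw [this]
    congr 2
    ring
  -- Near any time, finitely many passages make up the whole flow.
  have hloc : ∀ t, ∃ N : ℕ, t - s ≤ N ∧
      (fun r => flowEvolution B r s f) =ᶠ[𝓝 t] window (passageSum B s φ (N + 1)) := by
    intro t
    refine ⟨⌊t + 1 - s⌋₊ + 1, ?_, ?_⟩
    · push_cast
      linarith [Nat.lt_floor_add_one (t + 1 - s)]
    · filter_upwards [Iio_mem_nhds (lt_add_one t)] with r hr
      refine heq _ r ?_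
      have : ⌊r - s⌋₊ ≤ ⌊t + 1 - s⌋₊ := Nat.floor_mono (by linarith [mem_Iio.1 hr])
      omega
  have hC1 : ∀ N, ContDiff ℝ 1 (window (passageSum B s φ N)) := by
    intro N
    rw [contDiff_one_iff_deriv]
    refine ⟨fun t => (hasDerivAt_window (hw' N) t).differentiableAt, ?_⟩
    rw [funext fun t => (hasDerivAt_window (hw' N) t).deriv]
    exact continuous_window (hw' N).locallyIntegrable
  refine ⟨fun t _ => ?_, fun t ht => ?_⟩
  · obtain ⟨N, -, hN⟩ := hloc t
    exact ((hC1 (N + 1)).contDiffAt.congr_of_eventuallyEq hN).contDiffWithinAt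
  · obtain ⟨N, hN1, hN⟩ := hloc t
    have hd := ((hasDerivAt_window (hw' (N + 1)) t).congr_of_eventuallyEq
      hN).hasDerivWithinAt.derivWithin (uniqueDiffOn_Ici s t ht)
    simp only [hd, hN.eq_of_nhds]
    exact ⟨isWeakDeriv_window (hw' (N + 1)) t, _, _,
      hasTraces_window (hw' (N + 1)).continuous t, passageSum_add_one B hφ ht hN1⟩

variable {B} in
theorem solvesCauchy_flowEvolution
    (hB : ∀ v v' : ℝ → E → ℂ, IsPrimitive v v' → ∃ u', IsPrimitive (fun τ => B τ (v τ)) u') :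
    SolvesCauchy (fun t => BoundaryDerivOp fun a b => b = B t a) (flowEvolution B) :=
  ⟨isEvolutionFamily_flowEvolution B, fun s => by
    refine dense_testFunctions.mono ?_
    rintro f ⟨φ, hφ, hf⟩
    exact isClassicalSolution_flowEvolution hB s hφ hf⟩

end Evolution

/-! ### Uniqueness of classical solutions -/

section Uniqueness

variable {E : Type*} [Fintype E]

theorem continuous_partialInt : Continuous fun p : ℝ × FlowSpace E => partialInt p.1 p.2 := by
  refine continuous_prod_of_continuous_lipschitzWith' _ 1 (fun x => ?_)
    fun f => (isPrimitive_partialInt f).continuous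
  refine LipschitzWith.of_dist_le_mul fun f g => ?_
  rw [dist_eq_norm, dist_eq_norm, ← map_sub, NNReal.coe_one, one_mul]
  exact norm_partialInt_le x _

theorem continuous_integral_partialInt :
    Continuous fun f : FlowSpace E => ∫ x in (0 : ℝ)..1, partialInt x f := by
  refine intervalIntegral.continuous_parametric_intervalIntegral_of_continuous' ?_ 0 1
  exact continuous_partialInt.comp continuous_swap

/-- Differentiation of a partial integral with a moving endpoint, at a zero of the integrand. -/
theorem hasDerivAt_partialInt_of_eq_zero {v : ℝ → FlowSpace E} {v' : FlowSpace E} {r : ℝ}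
    (hv : HasDerivAt v v' r) (h0 : v r = 0) (c : ℝ) :
    HasDerivAt (fun q => partialInt (c - q) (v q)) (partialInt (c - r) v') r := by
  rw [hasDerivAt_iff_isLittleO] at hv ⊢
  simp only [h0, map_zero, sub_zero] at hv ⊢
  have h1 : (fun q => partialInt (c - q) (v q - (q - r) • v')) =o[𝓝 r] fun q => q - r :=
    (Asymptotics.isBigO_of_le _ fun q => norm_partialInt_le _ _).trans_isLittleO hv
  have h2 : (fun q => (q - r) • (partialInt (c - q) v' - partialInt (c - r) v'))
      =o[𝓝 r] fun q => q - r := by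
    have hc : Continuous fun q => partialInt (c - q) v' - partialInt (c - r) v' :=
      ((isPrimitive_partialInt v').continuous.comp
        (continuous_const.sub continuous_id)).sub continuous_const
    have h3 : (fun q => partialInt (c - q) v' - partialInt (c - r) v')
        =o[𝓝 r] fun _ => (1 : ℝ) := by
      rw [Asymptotics.isLittleO_one_iff]
      simpa using hc.tendsto r
    simpa using (Asymptotics.isBigO_refl (fun q : ℝ => q - r) (𝓝 r)).smul_isLittleO h3
  refine (h1.add h2).congr_left fun q => ?_
  rw [map_sub, (partialInt (E := E) (c - q)).map_smul_of_tower, smul_sub]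
  abel

/-- Along a characteristic, the partial integral of a solution `u_t = u_x` changes only by the
outflow at `0`: the contribution of the moving endpoint cancels against `∫ u_x`. -/
theorem hasDerivAt_partialInt_characteristic {u : ℝ → FlowSpace E} {u' : FlowSpace E} {r c : ℝ}
    {F : ℝ → E → ℂ} (hu : HasDerivAt u u' r) (hcont : ContinuousOn F (Icc 0 1))
    (hF : u r =ᵐ[volume.restrict (Icc (0 : ℝ) 1)] F)
    (hFx : ∀ x ∈ Icc (0 : ℝ) 1, F x = F 0 + partialInt x u') (hy : c - r ∈ Ioo (0 : ℝ) 1) :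
    HasDerivAt (fun q => partialInt (c - q) (u q)) (-F 0) r := by
  have h1 := hasDerivAt_partialInt_of_eq_zero (hu.sub_const (u r)) (sub_self _) c
  have h2 : HasDerivAt (fun y => partialInt y (u r)) (F (c - r)) (c - r) := by
    have h3 : HasDerivAt (fun y => ∫ z in (0 : ℝ)..y, F z) (F (c - r)) (c - r) := by
      refine intervalIntegral.integral_hasDerivAt_right ?_ ?_ ?_
      · refine (hcont.mono ?_).intervalIntegrable
        rw [uIcc_of_le hy.1.le]
        exact Icc_subset_Icc_right hy.2.le
      · exact (hcont.mono Ioo_subset_Icc_self).stronglyMeasurableAtFilter isOpen_Ioo _ hy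
      · exact hcont.continuousAt (Icc_mem_nhds hy.1 hy.2)
    refine h3.congr_of_eventuallyEq ?_
    filter_upwards [Ioo_mem_nhds hy.1 hy.2] with z hz
    exact partialInt_eq_of_ae (Ioo_subset_Icc_self hz) hF
  have h4 := h1.add (h2.scomp r ((hasDerivAt_id r).const_sub c))
  have h5 : partialInt (c - r) u' + (-1 : ℝ) • F (c - r) = -F 0 := by
    rw [hFx _ (Ioo_subset_Icc_self hy)]
    simp
  rw [h5] at h4
  refine h4.congr_of_eventuallyEq (.of_forall fun q => ?_)
  simp

/-- A classical solution of `u_t = u_x` is constant along the characteristics: it is given by the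
windows of the function `g(t) = u(0,t)`, and the boundary condition becomes a recursion for `g`. -/
theorem exists_recursion_of_isClassicalSolution {B : ℝ → (E → ℂ) → (E → ℂ)} {s : ℝ}
    {u : ℝ → FlowSpace E}
    (hu : IsClassicalSolution (fun t => BoundaryDerivOp fun a b => b = B t a) s u) :
    ∃ g : ℝ → E → ℂ, (∀ τ, s ≤ τ → g (τ + 1) = B τ (g τ)) ∧
      ∀ t, s ≤ t → u t =ᵐ[volume.restrict (Icc (0 : ℝ) 1)] fun x => g (t + x) := by
  obtain ⟨hC1, hA⟩ := hu
  set u' := derivWithin u (Ici s) with hu'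
  have huc : ContinuousOn u (Ici s) := hC1.continuousOn
  have hu'c : ContinuousOn u' (Ici s) := hC1.continuousOn_derivWithin (uniqueDiffOn_Ici s) le_rfl
  have hd : ∀ r, s < r → HasDerivAt u (u' r) r := fun r hr =>
    ((hC1.differentiableOn one_ne_zero r hr.le).hasDerivWithinAt).hasDerivAt (Ici_mem_nhds hr)
  -- `F t` is the continuous representative of `u t`.
  have hF : ∀ t : ℝ, ∃ F : ℝ → E → ℂ, s ≤ t → ContinuousOn F (Icc 0 1) ∧
      u t =ᵐ[volume.restrict (Icc (0 : ℝ) 1)] F ∧ F 1 = B t (F 0) := by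
    intro t
    by_cases ht : s ≤ t
    · obtain ⟨-, a, b, ⟨F, h1, h2, h3, h4⟩, h5⟩ := hA t ht
      exact ⟨F, fun _ => ⟨h1, h2, by rw [h3, h4]; exact h5⟩⟩
    · exact ⟨0, fun h => absurd h ht⟩
  choose F hF using hF
  have hFx : ∀ t, s ≤ t → ∀ x ∈ Icc (0 : ℝ) 1, F t x = F t 0 + partialInt x (u' t) :=
    fun t ht x hx => eq_add_partialInt_of_isWeakDeriv (hA t ht).1 (hF t ht).1 (hF t ht).2.1 hx
  have hFint : ∀ t, s ≤ t → ∀ x ∈ Icc (0 : ℝ) 1,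
      partialInt x (u t) = ∫ y in (0 : ℝ)..x, F t y :=
    fun t ht x hx => partialInt_eq_of_ae hx (hF t ht).2.1
  -- The trace at `0` is a continuous functional of `(u, u')`.
  have htrace : ∀ t, s ≤ t →
      F t 0 = partialInt 1 (u t) - ∫ x in (0 : ℝ)..1, partialInt x (u' t) := by
    intro t ht
    rw [hFint t ht 1 (by simp), eq_sub_iff_add_eq]
    have h1 : ∫ y in (0 : ℝ)..1, F t y = ∫ y in (0 : ℝ)..1, (F t 0 + partialInt y (u' t)) := by
      refine intervalIntegral.integral_congr fun y hy => ?_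
      rw [uIcc_of_le zero_le_one] at hy
      exact hFx t ht y hy
    rw [h1, intervalIntegral.integral_add (by simp)
      ((isPrimitive_partialInt (u' t)).continuous.intervalIntegrable _ _)]
    simp
  set g : ℝ → E → ℂ := fun τ => F (max τ s) 0 with hg
  have hgF : ∀ t, s ≤ t → g t = F t 0 := fun t ht => by simp only [hg, max_eq_left ht]
  have hgc : Continuous g := by
    have h1 : ContinuousOn (fun t => F t 0) (Ici s) := by
      refine ContinuousOn.congr ?_ htrace
      exact ((partialInt (E := E) 1).continuous.comp_continuousOn huc).sub
        (continuous_integral_partialInt.comp_continuousOn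
          (g := fun f : FlowSpace E => ∫ x in (0 : ℝ)..1, partialInt x f) hu'c)
    exact h1.comp_continuous (continuous_id.max continuous_const) fun τ => le_max_right τ s
  have hgl : LocallyIntegrable g volume := hgc.locallyIntegrable
  -- Follow the characteristic from `(t, x)` down to `(t + x, 0)`.
  have hchar : ∀ t, s ≤ t → ∀ x ∈ Icc (0 : ℝ) 1, partialInt x (u t) = ∫ y in t..t + x, g y := by
    intro t ht x hx
    have hderiv : ∀ r ∈ Ioo t (t + x),
        HasDerivAt (fun r => partialInt (t + x - r) (u r)) (-g r) r := by
      intro r hr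
      have hsr : s < r := ht.trans_lt hr.1
      rw [hgF r hsr.le]
      exact hasDerivAt_partialInt_characteristic (hd r hsr) (hF r hsr.le).1 (hF r hsr.le).2.1
        (hFx r hsr.le) ⟨by linarith [hr.2], by linarith [hr.1, hx.2]⟩
    have hcont : ContinuousOn (fun r => partialInt (t + x - r) (u r)) (Icc t (t + x)) :=
      continuous_partialInt.comp_continuousOn
        (g := fun p : ℝ × FlowSpace E => partialInt p.1 p.2) (f := fun r => (t + x - r, u r))
        ((continuous_const.sub continuous_id).continuousOn.prodMk
          (huc.mono fun r hr => ht.trans hr.1))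
    have h6 := intervalIntegral.integral_eq_sub_of_hasDerivAt_of_le (by linarith [hx.1]) hcont
      hderiv (hgc.neg.intervalIntegrable _ _)
    rw [intervalIntegral.integral_neg] at h6
    simp only [sub_self, partialInt_zero, zero_sub, add_sub_cancel_left, neg_inj] at h6
    exact h6.symm
  have hwin : ∀ t, s ≤ t → u t =ᵐ[volume.restrict (Icc (0 : ℝ) 1)] fun x => g (t + x) := by
    intro t ht
    have h1 : u t = window g t := by
      rw [← sub_eq_zero]
      refine eq_zero_of_partialInt_eq_zero fun x hx => ?_
      rw [map_sub, hchar t ht x hx, partialInt_window hgl t hx, sub_self]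
    rw [h1]
    exact window_ae hgl t
  refine ⟨g, fun τ hτ => ?_, hwin⟩
  have h1 : F τ 1 = g (τ + 1) :=
    Measure.eqOn_Icc_of_ae_eq volume zero_ne_one ((hF τ hτ).2.1.symm.trans (hwin τ hτ)) (hF τ hτ).1
      (hgc.comp (continuous_const.add continuous_id)).continuousOn (by simp)
  rw [← h1, (hF τ hτ).2.2, hgF τ hτ]

variable {B : C(ℝ, (E → ℂ) →L[ℂ] (E → ℂ))}

/-- Classical solutions are unique. -/
theorem eq_flowEvolution_of_isClassicalSolution {s : ℝ} {u : ℝ → FlowSpace E}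
    (hu : IsClassicalSolution (fun t => BoundaryDerivOp fun a b => b = B t a) s u) {t : ℝ}
    (hst : s ≤ t) : u t = flowEvolution B t s (u s) := by
  obtain ⟨g, hg, hug⟩ := exists_recursion_of_isClassicalSolution hu
  exact Lp.ext ((hug t hst).trans (flowEvolution_ae_of_recursion hst hg (hug s le_rfl)).symm)

/-- An evolution family with dense regularity subspaces is determined on these by the uniqueness of
classical solutions, hence everywhere. -/
theorem eq_flowEvolution_of_solvesCauchy {W : ℝ → ℝ → FlowSpace E →L[ℂ] FlowSpace E}
    (hW : SolvesCauchy (fun t => BoundaryDerivOp fun a b => b = B t a) W) {s t : ℝ}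
    (hst : s ≤ t) : W t s = flowEvolution B t s := by
  refine ContinuousLinearMap.ext fun f => congrFun (Continuous.ext_on (hW.2 s) (W t s).continuous
    (flowEvolution B t s).continuous fun f hf => ?_) f
  have := eq_flowEvolution_of_isClassicalSolution hf hst
  simpa only [hW.1.refl, ContinuousLinearMap.coe_id', id_eq] using this

end Uniqueness

/-! ### The network flow -/

section Network

open FlowNetwork

variable {V E : Type*} [Fintype V] [DecidableEq V] [Fintype E] [DecidableEq E]

theorem continuous_of_absolutelyContinuousOnInterval {f : ℝ → ℝ}
    (hf : ∀ a b : ℝ, AbsolutelyContinuousOnInterval f a b) : Continuous f :=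
  (IsPrimitive.of_real hf).continuous

/-- The matrices `Bw(t)` as a continuous family of operators on `ℂ^E`. -/
noncomputable def boundaryMap (G : FlowNetwork V E) (ω : V → E → ℝ → ℝ)
    (hac : ∀ i j, ∀ a b : ℝ, AbsolutelyContinuousOnInterval (ω i j) a b) :
    C(ℝ, (E → ℂ) →L[ℂ] (E → ℂ)) where
  toFun t := LinearMap.toContinuousLinearMap (Matrix.toLin' ((G.Bw ω t).map Complex.ofReal))
  continuous_toFun := by
    have h : Continuous fun t => (G.Bw ω t).map Complex.ofReal := by
      refine Continuous.matrix_map ?_ Complex.continuous_ofReal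
      refine Continuous.matrix_mul (Continuous.matrix_transpose ?_) continuous_const
      refine continuous_matrix fun i j => ?_
      by_cases hij : G.tail j = i
      · simpa [weightedOutInc, hij] using
          continuous_of_absolutelyContinuousOnInterval (hac i j)
      · simpa [weightedOutInc, hij] using continuous_const
    exact (LinearMap.continuous_of_finiteDimensional ((LinearMap.toContinuousLinearMap (𝕜 := ℂ)
      (E := E → ℂ) (F' := E → ℂ)).toLinearMap.comp
        (Matrix.toLin' (R := ℂ) (m := E) (n := E)).toLinearMap)).comp h

variable (G : FlowNetwork V E) {ω : V → E → ℝ → ℝ}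
  (hac : ∀ i j, ∀ a b : ℝ, AbsolutelyContinuousOnInterval (ω i j) a b)

theorem boundaryMap_apply (t : ℝ) (v : E → ℂ) :
    boundaryMap G ω hac t v = (G.Bw ω t).map Complex.ofReal *ᵥ v := rfl

theorem flowOp_eq (hoff : ∀ i j, G.outInc i j = 0 → ∀ t, ω i j t = 0) :
    G.flowOp ω = fun t => BoundaryDerivOp fun a b => b = boundaryMap G ω hac t a := by
  funext t
  have : G.BoundaryCondition ω t = fun a b => b = boundaryMap G ω hac t a := by
    funext a b
    exact propext (boundaryCondition_iff G ω hoff t a b)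
  rw [flowOp, this]

theorem boundaryMap_apply_eq_sum (t : ℝ) (v : E → ℂ) :
    boundaryMap G ω hac t v = ∑ j, ∑ k, ω (G.tail j) j t •
      (Pi.single j ((G.inInc (G.tail j) k : ℂ) * v k) : E → ℂ) := by
  funext l
  rw [boundaryMap_apply]
  simp [Bw, Matrix.mulVec, dotProduct, Matrix.mul_apply, weightedOutInc, Finset.sum_apply,
    Pi.single_apply, mul_assoc]

/-- Multiplication by `Bw` preserves local absolute continuity. -/
theorem exists_isPrimitive_boundaryMap {v v' : ℝ → E → ℂ} (hv : IsPrimitive v v') :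
    ∃ u', IsPrimitive (fun τ => boundaryMap G ω hac τ (v τ)) u' := by
  let L : E → E → (E → ℂ) →L[ℝ] (E → ℂ) := fun j k =>
    LinearMap.toContinuousLinearMap ((LinearMap.single ℝ (fun _ : E => ℂ) j).comp
      ((LinearMap.mulLeft ℝ (G.inInc (G.tail j) k : ℂ)).comp (LinearMap.proj k)))
  have := IsPrimitive.sum Finset.univ fun j (_ : j ∈ Finset.univ) =>
    IsPrimitive.sum Finset.univ fun k (_ : k ∈ Finset.univ) =>
      (IsPrimitive.of_real (hac (G.tail j) j)).smul (hv.clm_comp (L j k))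
  simp only [boundaryMap_apply_eq_sum]
  exact ⟨_, this⟩

theorem propagator_apply_of_periodic (hper : ∀ t, G.Bw ω (t + 1) = G.Bw ω t) (k : ℕ) (τ : ℝ)
    (v : E → ℂ) : propagator (boundaryMap G ω hac) k τ v =
      ((G.Bw ω τ).map Complex.ofReal) ^ k *ᵥ v := by
  induction k generalizing τ with
  | zero => simp [propagator]
  | succ k ih =>
    have h : G.Bw ω (τ - 1) = G.Bw ω τ := by rw [← hper, sub_add_cancel]
    rw [propagator, ContinuousLinearMap.comp_apply, ih, boundaryMap_apply, h, Matrix.mulVec_mulVec,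
      pow_succ']

end Network

end NetworkFlow

theorem mainTheorem3 {V E : Type*} [Fintype V] [DecidableEq V] [Fintype E] [DecidableEq E]
    (G : FlowNetwork V E) (ω : V → E → ℝ → ℝ)
    (hnonneg : ∀ i j t, 0 ≤ ω i j t)
    (hoff : ∀ i j, G.outInc i j = 0 → ∀ t, ω i j t = 0)
    (hsum : ∀ i, ∀ t, 0 ≤ t → ∑ j, ω i j t = 1)
    (hac : ∀ i j, ∀ a b : ℝ, AbsolutelyContinuousOnInterval (ω i j) a b) :
    IsWellPosed (G.flowOp ω) ∧
    ((∀ t, G.Bw ω (t + 1) = G.Bw ω t) →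
      ∀ U : ℝ → ℝ → FlowSpace E →L[ℂ] FlowSpace E, SolvesCauchy (G.flowOp ω) U →
        (∀ s t, s ≤ t → ∀ f : FlowSpace E, ∀ᵐ x ∂(volume.restrict (Icc (0 : ℝ) 1)),
          ∀ k : ℕ, (k : ℝ) ≤ x + t - s → x + t - s < k + 1 →
            (U t s f) x =
              ((G.Bw ω (t + x)).map Complex.ofReal) ^ k *ᵥ f (x + t - s - k)) ∧
        (∀ s, ∀ u : ℝ → FlowSpace E, IsClassicalSolution (G.flowOp ω) s u →
          ∀ t, s ≤ t → u t = U t s (u s))) := by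
  rw [NetworkFlow.flowOp_eq G hac hoff]
  refine ⟨⟨_, NetworkFlow.solvesCauchy_flowEvolution fun _ _ =>
      NetworkFlow.exists_isPrimitive_boundaryMap G hac,
    fun W hW s t hst => NetworkFlow.eq_flowEvolution_of_solvesCauchy hW hst⟩,
    fun hper U hU => ⟨fun s t hst f => ?_, fun s u hu t hst => ?_⟩⟩
  · rw [NetworkFlow.eq_flowEvolution_of_solvesCauchy hU hst]
    filter_upwards [NetworkFlow.flowEvolution_ae (NetworkFlow.boundaryMap G ω hac) t s f]
      with x hx k hk1 hk2
    rw [hx k hk1 hk2, NetworkFlow.propagator_apply_of_periodic G hac hper]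
  · rw [NetworkFlow.eq_flowEvolution_of_solvesCauchy hU hst]
    exact NetworkFlow.eq_flowEvolution_of_isClassicalSolution hu hst
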